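/- Let $n,m\ge 1$ and let $p_1,\dots,p_n,q_1,\dots,q_m$ be positive integers. Let $P$ be the standard diagram of the (non-alternating) pretzel link $K=K(p_1,\dots,p_n,-q_1,\dots,-q_m)$: it has $n+m$ vertical twisted columns side by side, with $p_1,\dots,p_n$ and then $q_1,\dots,q_m$ crossings, cyclically joined to their neighbours at the top and at the bottom. In the first $n$ columns the strand from the lower left to the upper right is the overcrossing one, and in the last $m$ columns it is the undercrossing one. Let $\det(K)=|V_K(-1)|$ be the determinant of $K$, where $V_K$ is the Jones polynomial of $K$ with any orientation, computed from the Kauffman bracket of $P$. Let $\mathbb D$ be the all-$A$ dessin of $P$. It is the ribbon graph whose vertices are the circles obtained by $A$-splicing all crossings of $P$, where a circle is directed anticlockwise if it is inside an even number of the other circles and clockwise otherwise; whose edges are the crossings; and in which the cyclic order of the edges at a vertex is the order in which the directed circle meets the crossings. Its genus is $g(\mathbb D)=(2k-v+e-f)/2$, where $k,v,e,f$ are the numbers of connected components, vertices, edges and faces of $\mathbb D$. Let $\mathbb D^*$ be the dual of $\mathbb D$, and let $\tau$ denote the number of spanning trees. Then $$g(\mathbb D)=1,\qquad \det(K)=\left|\prod_{i=1}^n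 p_i\prod_{j=1}^m q_j\left(\sum_{i=1}^n\frac1{p_i}-\sum_{j=1}^m\frac1{q_j}\right)\right|,\qquad \det(K)=\bigl|\tau(\mathbb D)-\tau(\mathbb D^*)\bigr|.$$ -/

import Mathlib

/-- A dessin d'enfant (combinatorial map, oriented ribbon graph) without isolated vertices:
a finite multigraph given by its half-edges (`Dart`), the permutation `rot` sending a half-edge to
the next one, counterclockwise, at the same vertex, and the fixed-point-free involution `flip`
exchanging the two halves of each edge. Loops and multiple edges are allowed. -/
structure Dessin where
  Dart : Type
  [fintypeDart : Fintype Dart]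
  rot : Equiv.Perm Dart
  flip : Equiv.Perm Dart
  flip_flip : ∀ h, flip (flip h) = h
  flip_ne : ∀ h, flip h ≠ h

namespace Dessin

attribute [instance] Dessin.fintypeDart

/-- The vertices are the cycles of `rot`. -/
def Vertex (D : Dessin) : Type := Quotient (Equiv.Perm.SameCycle.setoid D.rot)

/-- The edges are the cycles of `flip`. -/
def Edge (D : Dessin) : Type := Quotient (Equiv.Perm.SameCycle.setoid D.flip)

/-- The faces are the cycles of `rot ∘ flip`: walk along a half-edge to the other end of its edge,
then turn into the next half-edge at the vertex reached. -/
def Face (D : Dessin) : Type := Quotient (Equiv.Perm.SameCycle.setoid (D.rot * D.flip))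

/-- The connected components are the orbits of the group generated by `rot` and `flip`. -/
def Component (D : Dessin) : Type :=
  MulAction.orbitRel.Quotient (Subgroup.closure {D.rot, D.flip}) D.Dart

/-- The vertex at which a half-edge starts. -/
def vertexOf (D : Dessin) (h : D.Dart) : D.Vertex :=
  Quotient.mk (Equiv.Perm.SameCycle.setoid D.rot) h

/-- The edge that contains a half-edge. -/
def edgeOf (D : Dessin) (h : D.Dart) : D.Edge :=
  Quotient.mk (Equiv.Perm.SameCycle.setoid D.flip) h

/-- The genus `(2k - v + e - f) / 2`. -/
noncomputable def genus (D : Dessin) : ℚ :=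
  (2 * (Nat.card D.Component : ℚ) - Nat.card D.Vertex + Nat.card D.Edge - Nat.card D.Face) / 2

/-- The dual dessin: its vertices are the faces of `D`, its faces are the vertices of `D`, and each
edge is replaced by the edge that crosses it. The half-edge `h` of the dual starts in the face to
the right of the half-edge `h` of `D`. -/
def dual (D : Dessin) : Dessin where
  Dart := D.Dart
  rot := (D.rot * D.flip)⁻¹
  flip := D.flip
  flip_flip := D.flip_flip
  flip_ne := D.flip_ne

/-- The end points `u` and `v` are joined by an edge belonging to `T`. -/
def AdjIn (D : Dessin) (T : Set D.Edge) (u v : D.Vertex) : Prop :=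
  ∃ h : D.Dart, D.edgeOf h ∈ T ∧ D.vertexOf h = u ∧ D.vertexOf (D.flip h) = v

/-- `T` is the edge set of a spanning tree: the spanning subgraph with edge set `T` is connected and
has one edge less than it has vertices. -/
def IsSpanningTree (D : Dessin) (T : Set D.Edge) : Prop :=
  (∀ u v : D.Vertex, Relation.ReflTransGen (D.AdjIn T) u v) ∧ T.ncard + 1 = Nat.card D.Vertex

/-- The number of spanning trees. -/
noncomputable def numSpanningTrees (D : Dessin) : ℕ :=
  Nat.card {T : Set D.Edge // D.IsSpanningTree T}

end Dessin

/-- A link diagram (every component of which passes through a crossing), encoded as follows.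
Colour the regions of the diagram in black and white like a chessboard, the unbounded region white,
and direct every edge (arc between two crossings) so that the black region is on its left.
Then the four ends of edges at a crossing `c` are, in counterclockwise order,
`in false`, `out false`, `in true`, `out true`, where edges arrive at the `in` ends and
leave through the `out` ends.
* `edge (c, i) = (c', j)`: the edge leaving through `out i` at `c` arrives at `in j` at `c'`;
* `inOver c`: the strand of the link that joins the two opposite ends `in false` and `in true` is
  the overcrossing one at `c` (otherwise the strand joining `out false` and `out true` is).
These directions of the edges are not an orientation of the link. Every link diagram in the plane is
encoded in this way; data that do not come from a diagram in the plane describe chessboard-coloured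
diagrams on other closed oriented surfaces, and the definitions below make sense for them too. -/
structure LinkDiagram where
  Crossing : Type
  [fintypeCrossing : Fintype Crossing]
  [decEqCrossing : DecidableEq Crossing]
  edge : Equiv.Perm (Crossing × Bool)
  inOver : Crossing → Bool

namespace LinkDiagram

attribute [instance] LinkDiagram.fintypeCrossing LinkDiagram.decEqCrossing

/-- Exchange `false` and `true` in the second component. -/
def opp (C : Type) : Equiv.Perm (C × Bool) where
  toFun x := (x.1, !x.2)
  invFun x := (x.1, !x.2)
  left_inv x := by simp
  right_inv x := by simp

/-- A state is an assignment of a splicing to every crossing: `true` is the `A`-splicing and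
`false` is the `B`-splicing. -/
abbrev State (D : LinkDiagram) : Type := D.Crossing → Bool

/-- The splicing of the state `s` at the crossing `c` connects `in i` with the `out` end `turn (c, i)`.
The `A`-splicing at `c` merges the two regions that the overcrossing strand sweeps out when it is
turned counterclockwise towards the undercrossing strand. So if the `in` ends belong to the
undercrossing strand it connects `in i` with `out i`, and otherwise `in i` with `out !i`.
The `B`-splicing does the opposite. -/
def turn (D : LinkDiagram) (s : D.State) : Equiv.Perm (D.Crossing × Bool) where
  toFun x := (x.1, if s x.1 = D.inOver x.1 then !x.2 else x.2)
  invFun x := (x.1, if s x.1 = D.inOver x.1 then !x.2 else x.2)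
  left_inv x := by by_cases h : s x.1 = D.inOver x.1 <;> simp [h]
  right_inv x := by by_cases h : s x.1 = D.inOver x.1 <;> simp [h]

/-- The dessin of the state `s`. Its vertices are the circles of the spliced diagram. A circle has
black regions on its left, so it is directed anticlockwise if it is inside an even number of circles
and clockwise otherwise. Each crossing gives an edge, joining the two arcs of the splicing; the
half-edge `(c, i)` is attached to the arc that starts at the end `in i` of the crossing `c`. The
half-edges at a vertex are ordered as the directed circle meets them. -/
def dessin (D : LinkDiagram) (s : D.State) : Dessin where
  Dart := D.Crossing × Bool
  rot := D.edge * D.turn s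
  flip := opp D.Crossing
  flip_flip x := by simp [opp]
  flip_ne x := by simp [opp, Prod.ext_iff]

/-- The dessin of the state with `A`-splicings at all crossings. -/
def dessinA (D : LinkDiagram) : Dessin := D.dessin fun _ => true

/-- The number of circles of the diagram spliced according to `s`. -/
noncomputable def numCircles (D : LinkDiagram) (s : D.State) : ℕ := Nat.card (D.dessin s).Vertex

open LaurentPolynomial in
/-- The Kauffman bracket in `ℤ[A, A⁻¹]` (where `T k` is `A ^ k`), normalised to be `1` on
the diagrams with one circle and no crossing:
the sum of `A ^ (a(s) - b(s)) (-A² - A⁻²) ^ (circles(s) - 1)` over all states `s`, where `a(s)` and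
`b(s)` are the numbers of `A`- and `B`-splicings. -/
noncomputable def bracket (D : LinkDiagram) : LaurentPolynomial ℤ :=
  ∑ s : D.State, T (∑ c, if s c then (1 : ℤ) else -1) *
    (-T 2 - T (-2)) ^ (D.numCircles s - 1)

/-- An orientation of the link. `dir (c, i)` says whether the orientation of the link on the edge
that leaves `c` through `out i` agrees with the direction from the chessboard colouring. The
orientations have to be continued straight through each crossing: one of two opposite ends is run
through towards the crossing, and the other one away from it. -/
structure Orientation (D : LinkDiagram) where
  dir : D.Crossing × Bool → Bool
  out_strand : ∀ c, dir (c, true) = !dir (c, false)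
  in_strand : ∀ c, dir (D.edge.symm (c, true)) = !dir (D.edge.symm (c, false))

/-- If two permutations of order two have no fixed points, then the points can be coloured by `true`
and `false` so that both permutations change the colour of every point. -/
theorem exists_alternating {X : Type} (a b : Equiv.Perm X) (ha : ∀ x, a (a x) = x)
    (ha' : ∀ x, a x ≠ x) (hb : ∀ x, b (b x) = x) (hb' : ∀ x, b x ≠ x) :
    ∃ f : X → Bool, (∀ x, f (a x) = !f x) ∧ ∀ x, f (b x) = !f x := by
  classical
  have haa : a⁻¹ = a := inv_eq_of_mul_eq_one_left (Equiv.ext ha)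
  have hbb : b⁻¹ = b := inv_eq_of_mul_eq_one_left (Equiv.ext hb)
  set r : Equiv.Perm X := a * b with hr
  have hconj : a * r * a⁻¹ = r⁻¹ := by
    have h1 : a * a = 1 := Equiv.ext ha
    rw [hr, mul_inv_rev, haa, hbb, ← mul_assoc, h1, one_mul]
  have hz : ∀ (k : ℤ) (x : X), a ((r ^ k) x) = (r ^ (-k)) (a x) := by
    intro k x
    have h := conj_zpow (i := k) (a := a) (b := r)
    rw [hconj] at h
    have h2 := congrArg (fun g : Equiv.Perm X => g (a x)) h
    simpa [Equiv.Perm.mul_apply, inv_zpow'] using h2.symm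
  have key : ∀ x, ¬ r.SameCycle x (a x) := by
    rintro x ⟨k, hk⟩
    obtain ⟨j, rfl | rfl⟩ := Int.even_or_odd' k
    · apply ha' ((r ^ j) x)
      rw [hz, ← hk, ← Equiv.Perm.mul_apply, ← zpow_add]
      congr 2; ring
    · apply hb' ((r ^ j) x)
      have h1 : a (b ((r ^ j) x)) = a ((r ^ j) x) := by
        have h2 : -j + (2 * j + 1) = 1 + j := by ring
        have h3 : a (b ((r ^ j) x)) = (r ^ (1 + j)) x := by rw [zpow_add, zpow_one]; rfl
        rw [hz, ← hk, h3, ← h2, zpow_add]; rfl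
      exact a.injective h1
  let S := Equiv.Perm.SameCycle.setoid r
  have hresp : ∀ x y, r.SameCycle x y → r.SameCycle (a x) (a y) := by
    rintro x y ⟨k, rfl⟩
    exact ⟨-k, (hz k x).symm⟩
  obtain ⟨lin, -⟩ := exists_wellFoundedLT (Quotient S)
  have hne : ∀ x, (Quotient.mk S x) ≠ Quotient.mk S (a x) := fun x h => key x (Quotient.exact h)
  have hfa : ∀ x, decide (Quotient.mk S (a x) < Quotient.mk S (a (a x))) =
      !decide (Quotient.mk S x < Quotient.mk S (a x)) := by
    intro x
    rw [ha]
    rcases lt_or_gt_of_ne (hne x) with h | h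
    · simp [h, h.le]
    · simp [h, h.le]
  refine ⟨fun x => decide (Quotient.mk S x < Quotient.mk S (a x)), hfa, fun x => ?_⟩
  have h1 : Quotient.mk S (a (b x)) = Quotient.mk S x :=
    Quotient.sound (Equiv.Perm.SameCycle.symm ⟨1, by simp [hr]⟩)
  have h2 : Quotient.mk S (b x) = Quotient.mk S (a x) := by
    have h3 : r.SameCycle (a (a (b x))) (a x) := hresp _ _ (Quotient.exact h1)
    rw [ha] at h3
    exact Quotient.sound h3
  have := hfa x
  rw [ha] at this
  simp only [h1, h2]
  exact this

/-- Every link diagram can be oriented. -/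
theorem nonempty_orientation (D : LinkDiagram) : Nonempty D.Orientation := by
  obtain ⟨f, h1, h2⟩ := exists_alternating (opp D.Crossing)
    (D.edge.symm.permCongr (opp D.Crossing)) (fun x => by simp [opp])
    (fun x => by simp [opp, Prod.ext_iff]) (fun x => by simp [opp])
    (fun x => by
      intro h
      have := congrArg D.edge h
      simp [opp, Prod.ext_iff] at this)
  refine ⟨⟨f, fun c => ?_, fun c => ?_⟩⟩
  · have := h1 (c, false); simpa [opp] using this
  · have := h2 (D.edge.symm (c, false)); simpa [opp] using this

/-- The crossing is positive (right-handed): turning the direction of the overcrossing strand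
counterclockwise by less than a half-turn leads to the direction of the undercrossing strand. The
`in` strand runs from `in false` to `in true` if `dir (edge.symm (c, false))` holds, and the `out`
strand runs from `out true` to `out false` if `dir (c, false)` holds. -/
def Orientation.sign {D : LinkDiagram} (o : D.Orientation) (c : D.Crossing) : ℤ :=
  if ((o.dir (D.edge.symm (c, false)) == o.dir (c, false)) ^^ D.inOver c) then 1 else -1

/-- The writhe, the sum of the signs of all crossings. -/
def Orientation.writhe {D : LinkDiagram} (o : D.Orientation) : ℤ := ∑ c, o.sign c

open LaurentPolynomial in
/-- The Jones polynomial `(-A³) ^ (-writhe) ⟨D⟩`, as a Laurent polynomial in `A = t ^ (-1/4)`. -/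
noncomputable def Orientation.jones {D : LinkDiagram} (o : D.Orientation) : LaurentPolynomial ℤ :=
  C ((-1) ^ o.writhe.natAbs) * T (-3 * o.writhe) * D.bracket

/-- The complex number `exp (π i / 4)`, a value of `A` with `t = A⁻⁴ = -1`. -/
noncomputable def rootA : ℂˣ :=
  Units.mk0 (Complex.exp (Real.pi * Complex.I / 4)) (Complex.exp_ne_zero _)

/-- The determinant of the link, the absolute value of its Jones polynomial at `t = -1`. -/
noncomputable def Orientation.det {D : LinkDiagram} (o : D.Orientation) : ℝ :=
  ‖LaurentPolynomial.eval₂ (Int.castRingHom ℂ) rootA o.jones‖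

theorem sigma_fin_eq {N : ℕ} {f : Fin N → ℕ} {i j : Fin N} {k l : ℕ} {hk : k < f i} {hl : l < f j}
    (hij : i = j) (hkl : k = l) : (⟨i, ⟨k, hk⟩⟩ : Σ i : Fin N, Fin (f i)) = ⟨j, ⟨l, hl⟩⟩ := by
  subst hij; subst hkl; rfl

/-- The standard diagram of the pretzel link `K(a 0, …, a (N - 1))`. It consists of vertical columns
next to each other, the `i`-th of which is a twist of two strands with `|a i|` crossings;
`⟨i, k⟩` is the crossing number `k` from the top in column `i`. The upper right end of each column is
joined to the upper left end of the next one, the lower right end to the lower left end of the next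
one, and the last column is joined to the first one in the same way around the diagram.
The unbounded region is to the left and to the right of all columns, so the regions to the left and
to the right of a crossing are white, and those above and below it are black. Hence
`in false`, `out false`, `in true`, `out true` are the upper left, lower left, lower right, and upper
right end of a crossing. In a column with `0 < a i` the strands from the lower left to the upper
right are the overcrossing ones, so that the `A`-splicing of a crossing consists of a left and a
right arc; in a column with `a i < 0` it is the other way round. -/
def pretzel {N : ℕ} (a : Fin N → ℤ) (ha : ∀ i, a i ≠ 0) : LinkDiagram where
  Crossing := Σ i : Fin N, Fin (a i).natAbs
  edge :=
    { toFun := fun x => match x with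
        | (⟨i, k⟩, false) =>
          if h : k.1 + 1 < (a i).natAbs then (⟨i, ⟨k.1 + 1, h⟩⟩, false)
          else
            (⟨(finRotate N).symm i, ⟨(a ((finRotate N).symm i)).natAbs - 1,
              Nat.sub_lt (Int.natAbs_pos.2 (ha _)) Nat.one_pos⟩⟩, true)
        | (⟨i, k⟩, true) =>
          if 0 < k.1 then (⟨i, ⟨k.1 - 1, lt_of_le_of_lt (Nat.sub_le _ _) k.2⟩⟩, true)
          else (⟨finRotate N i, ⟨0, Int.natAbs_pos.2 (ha _)⟩⟩, false)
      invFun := fun x => match x with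
        | (⟨i, k⟩, false) =>
          if 0 < k.1 then (⟨i, ⟨k.1 - 1, lt_of_le_of_lt (Nat.sub_le _ _) k.2⟩⟩, false)
          else (⟨(finRotate N).symm i, ⟨0, Int.natAbs_pos.2 (ha _)⟩⟩, true)
        | (⟨i, k⟩, true) =>
          if h : k.1 + 1 < (a i).natAbs then (⟨i, ⟨k.1 + 1, h⟩⟩, true)
          else
            (⟨finRotate N i, ⟨(a (finRotate N i)).natAbs - 1,
              Nat.sub_lt (Int.natAbs_pos.2 (ha _)) Nat.one_pos⟩⟩, false)
      left_inv := by
        rintro ⟨⟨i, k, hk⟩, _ | _⟩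
        · by_cases h : k + 1 < (a i).natAbs
          · simp [h]
          · simp only [h, dite_false]
            rw [dif_neg (by have := Int.natAbs_pos.2 (ha ((finRotate N).symm i)); omega)]
            refine Prod.ext (sigma_fin_eq (f := fun i => (a i).natAbs) ((finRotate N).apply_symm_apply i) ?_) rfl
            simp only [Equiv.apply_symm_apply]; omega
        · by_cases h : 0 < k
          · have h' : k - 1 + 1 = k := by omega
            simp only [h, if_true, h', hk, dite_true]
          · simp only [h, if_false, lt_irrefl]
            exact Prod.ext (sigma_fin_eq (f := fun i => (a i).natAbs) ((finRotate N).symm_apply_apply i) (by omega)) rfl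
      right_inv := by
        rintro ⟨⟨i, k, hk⟩, _ | _⟩
        · by_cases h : 0 < k
          · have h' : k - 1 + 1 = k := by omega
            simp only [h, if_true, h', hk, dite_true]
          · simp only [h, if_false, lt_irrefl]
            exact Prod.ext (sigma_fin_eq (f := fun i => (a i).natAbs) ((finRotate N).apply_symm_apply i) (by omega)) rfl
        · by_cases h : k + 1 < (a i).natAbs
          · simp [h]
          · simp only [h, dite_false]
            rw [dif_neg (by have := Int.natAbs_pos.2 (ha (finRotate N i)); omega)]
            refine Prod.ext (sigma_fin_eq (f := fun i => (a i).natAbs) ((finRotate N).symm_apply_apply i) ?_) rfl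
            simp only [Equiv.symm_apply_apply]; omega }
  inOver c := decide (a c.1 < 0)

/-- The pretzel link diagram `K(p₁, …, pₙ, -q₁, …, -qₘ)`. -/
def pretzelPQ {n m : ℕ} (p : Fin n → ℕ) (q : Fin m → ℕ) (hp : ∀ i, 0 < p i) (hq : ∀ j, 0 < q j) :
    LinkDiagram :=
  pretzel (Fin.append (fun i => (p i : ℤ)) (fun j => -(q j : ℤ))) (by
    intro i
    refine Fin.addCases (fun i => ?_) (fun j => ?_) i
    · have := hp i; simp only [Fin.append_left]; omega
    · have := hq j; simp only [Fin.append_right]; omega)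

end LinkDiagram

/-! At `A = exp (π i / 4)` the loop value `-A² - A⁻²` vanishes, so only the states with a single
circle contribute to the bracket. In a pretzel diagram each splicing is either vertical (a left and
a right arc) or horizontal (an upper and a lower arc). A single circle arises exactly when one
column `i` is spliced vertically throughout and every other column has exactly one horizontal
crossing (`IsUnicursal.eq`, `exists_isUnicursal`). The horizontal crossings are chosen freely, so
column `i` accounts for `∏ j ≠ i, |a j|` states (`card_isUnicursal`). Their `A`-exponents depend
only on the sign of `a i` and are `K + 2` or `K - 2` with a common `K`, so each contributes `± i A ^
K`. This gives the formula for the determinant.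

In the dessin, a positive column is a bundle of parallel edges between two consecutive circles of a
ring, and a negative column is a cycle attached at one circle of the ring. Switching the splicing
along an edge set `T` produces the boundary of the ribbon subgraph with edges `T`, so a spanning
tree yields one circle. The single-circle states obtained from spanning trees are those whose uncut
column is positive (`isTree_iff`). The dual comes from the all-`B` state, which exchanges the roles
of the signs. So the two tree numbers are the positive and the negative part of the sum for the
determinant. For the genus, each column contributes as much to `v + f` as to `e`, and the dessin is
connected.

Circles are handled through functions that are constant on them: such a function shows that two
circles differ, and the quotient map shows that two darts lie on the same circle. -/

/-- A property that is passed on by `finRotate` and holds somewhere holds everywhere. -/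
theorem finRotate_induction {N : ℕ} {P : Fin N → Prop} (i₀ : Fin N) (h₀ : P i₀)
    (h : ∀ j, P j → P (finRotate N j)) (j : Fin N) : P j := by
  -- The rotation is a cycle without fixed points only from two elements on.
  obtain _ | _ | N := N
  · exact j.elim0
  · rwa [show j = i₀ from Fin.ext (by omega)]
  · have hc := isCycle_finRotate (n := N)
    have hs : ∀ i : Fin (N + 2), finRotate (N + 2) i ≠ i := fun i => by
      rw [← Equiv.Perm.mem_support, support_finRotate]; exact Finset.mem_univ _
    obtain ⟨k, -, rfl⟩ := (hc.sameCycle (hs i₀) (hs j)).exists_pow_eq'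
    induction k with
    | zero => simpa using h₀
    | succ k ih => rw [pow_succ', Equiv.Perm.mul_apply]; exact h _ ih

theorem finRotate_val {N : ℕ} (i : Fin N) :
    (finRotate N i).1 = if i.1 + 1 = N then 0 else i.1 + 1 := by
  obtain _ | N := N
  · exact i.elim0
  · rw [coe_finRotate]; simp [Fin.ext_iff]

/-! ### Spliced twist columns and the count of horizontal crossings -/

namespace TwistColumns

variable {N : ℕ} {b : Fin N → ℕ}

/-- The upper left end of a column. -/
def upperLeft (hb : ∀ i, 0 < b i) (i : Fin N) : (Σ i, Fin (b i)) × Bool := (⟨i, 0, hb i⟩, false)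

/-- The lower right end of a column. -/
def lowerRight (hb : ∀ i, 0 < b i) (i : Fin N) : (Σ i, Fin (b i)) × Bool :=
  (⟨i, b i - 1, Nat.sub_lt (hb i) Nat.one_pos⟩, true)

/-- `F` is constant on the circles obtained from cyclically joined columns by splicing the crossings
`c` with `t c = true` vertically and the others horizontally. -/
structure ColumnInvariant (hb : ∀ i, 0 < b i) (t : (Σ i, Fin (b i)) → Bool) {X : Type*}
    (F : (Σ i, Fin (b i)) × Bool → X) : Prop where
  -- A dart is named after the end where its arc starts, `false` for upper left and `true` for lower
  -- right. The arc that leaves through the lower left end started at the upper left if the splicing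
  -- is vertical and at the lower right otherwise.
  down : ∀ i k (h : k + 1 < b i), F (⟨i, k + 1, h⟩, false) =
    F (⟨i, k, Nat.lt_of_succ_lt h⟩, !t ⟨i, k, Nat.lt_of_succ_lt h⟩)
  up : ∀ i k (h : k + 1 < b i), F (⟨i, k, Nat.lt_of_succ_lt h⟩, true) =
    F (⟨i, k + 1, h⟩, t ⟨i, k + 1, h⟩)
  top : ∀ i, F (upperLeft hb (finRotate N i)) = F (⟨i, 0, hb i⟩, t ⟨i, 0, hb i⟩)
  bottom : ∀ i, F (lowerRight hb i) =
    F ((lowerRight hb (finRotate N i)).1, !t (lowerRight hb (finRotate N i)).1)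

/-- The number of horizontally spliced crossings among the first `k` ones of column `i`. -/
def cuts (t : (Σ i, Fin (b i)) → Bool) (i : Fin N) (k : ℕ) : ℕ :=
  (Finset.univ.filter fun y : Fin (b i) => y.1 < k ∧ t ⟨i, y⟩ = false).card

theorem cuts_zero (t : (Σ i, Fin (b i)) → Bool) (i : Fin N) : cuts t i 0 = 0 := by simp [cuts]

theorem cuts_succ (t : (Σ i, Fin (b i)) → Bool) (i : Fin N) {k : ℕ} (hk : k < b i) :
    cuts t i (k + 1) = cuts t i k + if t ⟨i, k, hk⟩ then 0 else 1 := by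
  unfold cuts
  cases h : t ⟨i, k, hk⟩
  · rw [if_neg Bool.false_ne_true, ← Finset.card_insert_of_notMem (a := ⟨k, hk⟩)
      (s := Finset.univ.filter fun y : Fin (b i) => y.1 < k ∧ t ⟨i, y⟩ = false) (by simp)]
    congr 1
    ext y
    simp only [Finset.mem_filter, Finset.mem_univ, true_and, Finset.mem_insert, Fin.ext_iff]
    constructor
    · rintro ⟨h1, h2⟩
      rcases Nat.lt_succ_iff_lt_or_eq.1 h1 with h3 | h3
      · exact Or.inr ⟨h3, h2⟩
      · exact Or.inl h3
    · rintro (h1 | ⟨h1, h2⟩)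
      · obtain rfl : y = ⟨k, hk⟩ := Fin.ext h1
        exact ⟨Nat.lt_succ_self _, h⟩
      · exact ⟨by omega, h2⟩
  · simp only [if_true, add_zero]
    congr 1
    ext y
    simp only [Finset.mem_filter, Finset.mem_univ, true_and]
    refine and_congr_left fun h2 => ⟨fun h1 => ?_, fun h1 => by omega⟩
    rcases Nat.lt_succ_iff_lt_or_eq.1 h1 with h3 | h3
    · exact h3
    · obtain rfl : y = ⟨k, hk⟩ := Fin.ext h3
      rw [h] at h2; cases h2

theorem cuts_mono (t : (Σ i, Fin (b i)) → Bool) (i : Fin N) : Monotone (cuts t i) :=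
  fun _ _ h => Finset.card_le_card (Finset.monotone_filter_right _ fun _ _ ha =>
    ⟨ha.1.trans_le h, ha.2⟩)

theorem cuts_all (t : (Σ i, Fin (b i)) → Bool) (i : Fin N) :
    cuts t i (b i) = (Finset.univ.filter fun y : Fin (b i) => t ⟨i, y⟩ = false).card := by
  simp [cuts]

theorem cuts_all_eq_zero {t : (Σ i, Fin (b i)) → Bool} {i : Fin N} :
    cuts t i (b i) = 0 ↔ ∀ k, t ⟨i, k⟩ = true := by
  rw [cuts_all, Finset.card_eq_zero, Finset.filter_eq_empty_iff]; simp

theorem cuts_all_eq_one {t : (Σ i, Fin (b i)) → Bool} {i : Fin N} :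
    cuts t i (b i) = 1 ↔ ∃ h, ∀ k, t ⟨i, k⟩ = false ↔ k = h := by
  rw [cuts_all, Finset.card_eq_one]; simp [Finset.ext_iff]

/-- `cuts` starts at zero and grows by at most one per crossing, so its first positive value is one.
-/
theorem exists_cuts_eq_one {t : (Σ i, Fin (b i)) → Bool} {i : Fin N} (h : 1 ≤ cuts t i (b i)) :
    ∃ k, k < b i ∧ cuts t i k = 0 ∧ cuts t i (k + 1) = 1 := by
  have hex : ∃ k, 1 ≤ cuts t i k := ⟨_, h⟩
  obtain ⟨hk, hmin⟩ := (Nat.find_eq_iff hex).1 rfl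
  set k := Nat.find hex
  obtain _ | k := k
  · rw [cuts_zero] at hk; omega
  · have h0 := hmin k (Nat.lt_succ_self k)
    have hkb : k < b i := by
      by_contra hc
      exact h0 (h.trans (cuts_mono t i (not_lt.1 hc)))
    have := cuts_succ t i hkb
    exact ⟨k, hkb, by omega, by split_ifs at this <;> omega⟩

/-- The column `i₀` is spliced vertically, and in all other columns precisely one crossing is
spliced horizontally. -/
def IsUnicursal (t : (Σ i, Fin (b i)) → Bool) (i₀ : Fin N) : Prop :=
  cuts t i₀ (b i₀) = 0 ∧ ∀ j, j ≠ i₀ → cuts t j (b j) = 1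

theorem IsUnicursal.unique {t : (Σ i, Fin (b i)) → Bool} {i j : Fin N} (hi : IsUnicursal t i)
    (hj : IsUnicursal t j) : i = j := by
  by_contra h
  have := hi.1
  have := hj.2 i h
  omega

/-! ### Unicursal states have one circle -/

section Invariant

variable {hb : ∀ i, 0 < b i} {t : (Σ i, Fin (b i)) → Bool} {X : Type*}
  {F : (Σ i, Fin (b i)) × Bool → X}

theorem ColumnInvariant.left_of_forall (hF : ColumnInvariant hb t F) {i : Fin N} {k : ℕ}
    (hk : k < b i) (h : ∀ l (hl : l < k), t ⟨i, l, hl.trans hk⟩ = true) :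
    F (⟨i, k, hk⟩, false) = F (upperLeft hb i) := by
  induction k with
  | zero => rfl
  | succ k ih =>
    rw [hF.down, h k (Nat.lt_succ_self k)]
    exact ih _ fun l hl => h l (by omega)

theorem ColumnInvariant.right_of_forall (hF : ColumnInvariant hb t F) {i : Fin N} {k : ℕ}
    (hk : k < b i) (h : ∀ l, k < l → ∀ (hl : l < b i), t ⟨i, l, hl⟩ = true) :
    F (⟨i, k, hk⟩, true) = F (lowerRight hb i) := by
  obtain ⟨d, hd⟩ : ∃ d, k + d + 1 = b i := ⟨b i - 1 - k, by omega⟩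
  induction d generalizing k with
  | zero =>
    obtain rfl : k = b i - 1 := by omega
    rfl
  | succ d ih =>
    rw [hF.up i k (by omega), h (k + 1) (by omega)]
    exact ih _ (fun l hl => h l (by omega)) (by omega)

/-- In a column with precisely one horizontally spliced crossing, every dart is joined to the
upper left or the lower right end, depending on its height. -/
theorem ColumnInvariant.of_one_cut (hF : ColumnInvariant hb t F) {i : Fin N} {h : Fin (b i)}
    (ht : ∀ k, t ⟨i, k⟩ = false ↔ k = h) (k : Fin (b i)) :
    (k ≤ h → F (⟨i, k⟩, false) = F (upperLeft hb i)) ∧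
    (k < h → F (⟨i, k⟩, true) = F (upperLeft hb i)) ∧
    (h < k → F (⟨i, k⟩, false) = F (lowerRight hb i)) ∧
    (h ≤ k → F (⟨i, k⟩, true) = F (lowerRight hb i)) := by
  have ht' : ∀ l (hl : l < b i), l ≠ h.1 → t ⟨i, l, hl⟩ = true := fun l hl hne => by
    rw [← Bool.not_eq_false, ht]; exact fun e => hne (congrArg Fin.val e)
  have hth : t ⟨i, h⟩ = false := (ht h).2 rfl
  have h1 : ∀ k : Fin (b i), k ≤ h → F (⟨i, k⟩, false) = F (upperLeft hb i) := fun k hk =>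
    hF.left_of_forall k.2 fun l hl => ht' _ _ (by have : k.1 ≤ h.1 := hk; omega)
  have h4 : ∀ k : Fin (b i), h ≤ k → F (⟨i, k⟩, true) = F (lowerRight hb i) := fun k hk =>
    hF.right_of_forall k.2 fun l hl hl' => ht' _ _ (by have : h.1 ≤ k.1 := hk; omega)
  refine ⟨h1 k, ?_, ?_, h4 k⟩
  · obtain ⟨k, hk⟩ := k
    intro hlt
    replace hlt : k < h.1 := hlt
    -- The right side above the cut is followed down to the cut, whose upper arc leads over to the
    -- left side. Below the cut, the left side is followed up to its lower arc in the same way.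
    obtain ⟨d, hd⟩ : ∃ d, k + d + 1 = h.1 := ⟨h.1 - 1 - k, by omega⟩
    induction d generalizing k with
    | zero =>
      obtain ⟨h, hh⟩ := h
      obtain rfl : k + 1 = h := hd
      rw [hF.up i k hh, hth]
      exact h1 _ le_rfl
    | succ d ih =>
      rw [hF.up i k (by have := h.2; omega), ht' _ _ (by omega)]
      exact ih (k + 1) _ (by omega) (by omega)
  · obtain ⟨k, hk⟩ := k
    intro hlt
    replace hlt : h.1 < k := hlt
    induction k with
    | zero => omega
    | succ k ih =>
      rw [hF.down]
      by_cases hkh : k = h.1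
      · obtain ⟨h, hh⟩ := h
        obtain rfl : k = h := hkh
        rw [hth]
        exact h4 _ le_rfl
      · rw [ht' _ _ hkh]
        exact ih (Nat.lt_of_succ_lt hk) (by omega)

/-- The splicing of a unicursal state consists of one circle. -/
theorem IsUnicursal.eq {i₀ : Fin N} (hu : IsUnicursal t i₀) (hF : ColumnInvariant hb t F)
    (x y : (Σ i, Fin (b i)) × Bool) : F x = F y := by
  obtain ⟨h0, h1⟩ := hu
  rw [cuts_all_eq_zero] at h0
  have hl0 : ∀ k, F (⟨i₀, k⟩, false) = F (upperLeft hb i₀) := fun k =>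
    hF.left_of_forall k.2 fun _ _ => h0 _
  have hr0 : ∀ k, F (⟨i₀, k⟩, true) = F (lowerRight hb i₀) := fun k =>
    hF.right_of_forall k.2 fun _ _ _ => h0 _
  -- The part of a once-cut column above the cut joins its upper left end to that of the next
  -- column; `hcol'` is the same for the parts below the cuts.
  have hcol : ∀ j, j ≠ i₀ → F (upperLeft hb (finRotate N j)) = F (upperLeft hb j) := by
    intro j hj
    obtain ⟨h, hh⟩ := cuts_all_eq_one.1 (h1 j hj)
    rw [hF.top]
    cases hc : t ⟨j, 0, hb j⟩
    · rfl
    · refine (hF.of_one_cut hh _).2.1 (Fin.lt_def.2 (Nat.pos_of_ne_zero fun h00 => ?_))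
      rw [← Bool.not_eq_false, hh] at hc
      exact hc (Fin.ext h00.symm)
  have hcol' : ∀ j, finRotate N j ≠ i₀ →
      F (lowerRight hb (finRotate N j)) = F (lowerRight hb j) := by
    intro j hj
    obtain ⟨h, hh⟩ := cuts_all_eq_one.1 (h1 _ hj)
    rw [hF.bottom j]
    cases hc : t (lowerRight hb (finRotate N j)).1
    · rfl
    · refine ((hF.of_one_cut hh _).2.2.1 (Fin.lt_def.2 ?_)).symm
      refine lt_of_le_of_ne (by have := h.2; simp only; omega) fun h00 => ?_
      rw [← Bool.not_eq_false] at hc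
      exact hc ((hh _).2 (Fin.ext h00.symm))
  -- The right side of column `i₀` ties the tops to the bottoms, so the walk along the tops begins
  -- just after `i₀`.
  have hul : ∀ j, F (upperLeft hb j) = F (lowerRight hb i₀) := by
    refine finRotate_induction (finRotate N i₀) ?_ fun j hj => ?_
    · rw [hF.top, h0, hr0]
    · by_cases h : j = i₀
      · rw [h, hF.top, h0, hr0]
      · rw [hcol j h, hj]
  have hlr : ∀ j, F (lowerRight hb j) = F (lowerRight hb i₀) := by
    refine finRotate_induction i₀ rfl fun j hj => ?_
    by_cases h : finRotate N j = i₀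
    · rw [h]
    · rw [hcol' j h, hj]
  suffices ∀ x, F x = F (lowerRight hb i₀) by rw [this x, this y]
  rintro ⟨⟨i, k⟩, c⟩
  by_cases hi : i = i₀
  · subst hi
    cases c
    · rw [hl0, hul]
    · exact hr0 k
  · obtain ⟨h, hh⟩ := cuts_all_eq_one.1 (h1 i hi)
    obtain ⟨e1, e2, e3, e4⟩ := hF.of_one_cut hh k
    cases c
    · rcases le_or_gt k h with hk | hk
      · rw [e1 hk, hul]
      · rw [e3 hk, hlr]
    · rcases lt_or_ge k h with hk | hk
      · rw [e2 hk, hul]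
      · rw [e4 hk, hlr]

end Invariant

/-! ### One circle forces a unicursal state -/

/-- The number of horizontally spliced crossings above a dart. -/
def cutsAbove (t : (Σ i, Fin (b i)) → Bool) (x : (Σ i, Fin (b i)) × Bool) : ℕ :=
  cuts t x.1.1 (x.1.2.1 + x.2.toNat)

theorem cutsAbove_down (t : (Σ i, Fin (b i)) → Bool) {i k} (h : k + 1 < b i) :
    cutsAbove t (⟨i, k + 1, h⟩, false) =
    cutsAbove t (⟨i, k, Nat.lt_of_succ_lt h⟩, !t ⟨i, k, Nat.lt_of_succ_lt h⟩) := by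
  have := cuts_succ t i (Nat.lt_of_succ_lt h)
  simp only [cutsAbove, Bool.toNat_false, add_zero]
  cases ht : t ⟨i, k, Nat.lt_of_succ_lt h⟩
  · rfl
  · simpa [ht] using this

theorem cutsAbove_up (t : (Σ i, Fin (b i)) → Bool) {i k} (h : k + 1 < b i) :
    cutsAbove t (⟨i, k, Nat.lt_of_succ_lt h⟩, true) =
    cutsAbove t (⟨i, k + 1, h⟩, t ⟨i, k + 1, h⟩) := by
  have := cuts_succ t i h
  simp only [cutsAbove, Bool.toNat_true]
  cases ht : t ⟨i, k + 1, h⟩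
  · rfl
  · simpa [ht] using this.symm

theorem cutsAbove_upperLeft (hb : ∀ i, 0 < b i) (t : (Σ i, Fin (b i)) → Bool) (i) :
    cutsAbove t (upperLeft hb i) = 0 := cuts_zero t i

theorem cutsAbove_top (hb : ∀ i, 0 < b i) (t : (Σ i, Fin (b i)) → Bool) (i) :
    cutsAbove t (⟨i, 0, hb i⟩, t ⟨i, 0, hb i⟩) = 0 := by
  have := cuts_succ t i (hb i)
  simp only [cutsAbove]
  cases ht : t ⟨i, 0, hb i⟩
  · exact cuts_zero t i
  · simpa [ht, cuts_zero] using this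

theorem cutsAbove_lowerRight (hb : ∀ i, 0 < b i) (t : (Σ i, Fin (b i)) → Bool) (i) :
    cutsAbove t (lowerRight hb i) = cuts t i (b i) := by
  have := hb i
  simp only [cutsAbove, lowerRight, Bool.toNat_true]
  congr 1; omega

theorem cutsAbove_bottom (hb : ∀ i, 0 < b i) (t : (Σ i, Fin (b i)) → Bool) (i) :
    cutsAbove t ((lowerRight hb i).1, !t (lowerRight hb i).1) = cuts t i (b i) := by
  rw [← cutsAbove_lowerRight hb]
  have h := hb i
  have := cuts_succ t i (Nat.sub_lt h Nat.one_pos)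
  simp only [cutsAbove, lowerRight, Bool.toNat_true]
  cases ht : t ⟨i, b i - 1, Nat.sub_lt h Nat.one_pos⟩
  · rfl
  · simpa [ht] using this.symm

/-- If the splicing consists of one circle, the state is unicursal. -/
theorem exists_isUnicursal (hb : ∀ i, 0 < b i) (hN : 0 < N) {t : (Σ i, Fin (b i)) → Bool}
    (h : ∀ F : (Σ i, Fin (b i)) × Bool → Prop, ColumnInvariant hb t F → ∀ x y, F x → F y) :
    ∃ i₀, IsUnicursal t i₀ := by
  -- With two cuts in a column, the arcs between the first and the second one close up, so the
  -- indicator of this level is an invariant.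
  have h2 : ∀ i, cuts t i (b i) ≤ 1 := by
    by_contra! hc
    obtain ⟨i, hi⟩ := hc
    obtain ⟨k, hk, -, h1⟩ := exists_cuts_eq_one hi.le
    have hF : ColumnInvariant hb t (fun x => x.1.1 = i ∧ cutsAbove t x = 1) := by
      refine ⟨fun j l hl => ?_, fun j l hl => ?_, fun j => ?_, fun j => ?_⟩
      · simp only [cutsAbove_down]
      · simp only [cutsAbove_up t hl]
      · simp only [cutsAbove_upperLeft, cutsAbove_top]; simp
      · simp only [cutsAbove_lowerRight, cutsAbove_bottom, eq_iff_iff]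
        constructor
        · rintro ⟨h4, h5⟩
          have : (lowerRight hb j).1.1 = j := rfl
          rw [this] at h4
          rw [h4] at h5
          omega
        · rintro ⟨h4, h5⟩
          have : (lowerRight hb (finRotate N j)).1.1 = finRotate N j := rfl
          rw [this] at h4
          rw [h4] at h5
          omega
    have := h _ hF (⟨i, k, hk⟩, true) (upperLeft hb i) ⟨rfl, h1⟩
    simp [cutsAbove_upperLeft] at this
  -- If every column is cut, the arcs above all first cuts are separated from the bottom.
  have h0 : ∃ i, cuts t i (b i) = 0 := by
    by_contra! hc
    have hF : ColumnInvariant hb t (fun x => cutsAbove t x = 0) := by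
      refine ⟨fun j l hl => ?_, fun j l hl => ?_, fun j => ?_, fun j => ?_⟩
      · simp only [cutsAbove_down]
      · simp only [cutsAbove_up t hl]
      · simp only [cutsAbove_upperLeft, cutsAbove_top]
      · simp only [cutsAbove_lowerRight, cutsAbove_bottom, hc]
    have := h _ hF (upperLeft hb ⟨0, hN⟩) (lowerRight hb ⟨0, hN⟩) (cutsAbove_upperLeft _ _ _)
    exact hc _ ((cutsAbove_lowerRight hb t _).symm.trans this)
  obtain ⟨i₀, hi₀⟩ := h0
  refine ⟨i₀, hi₀, fun j hj => le_antisymm (h2 j) (Nat.one_le_iff_ne_zero.2 fun hj0 => ?_)⟩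
  -- With two uncut columns, everything between them, including the right side of `i₁` and the left
  -- side of `i₂`, is closed off. The left side of `i₁` lies outside.
  have key : ∀ i₁ i₂ : Fin N, i₁ < i₂ → cuts t i₁ (b i₁) = 0 → cuts t i₂ (b i₂) = 0 → False := by
    intro i₁ i₂ hlt e1 e2
    rw [cuts_all_eq_zero] at e1 e2
    have hF : ColumnInvariant hb t (fun x =>
        (i₁ < x.1.1 ∧ x.1.1 < i₂) ∨ (x.1.1 = i₁ ∧ x.2 = true) ∨ (x.1.1 = i₂ ∧ x.2 = false)) := by
      have ht : ∀ i (k : Fin (b i)), t ⟨i, k⟩ = false → i ≠ i₁ ∧ i ≠ i₂ := by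
        refine fun i k hk => ⟨?_, ?_⟩
        · rintro rfl; rw [e1] at hk; cases hk
        · rintro rfl; rw [e2] at hk; cases hk
      have hlt' : i₁.1 < i₂.1 := hlt
      refine ⟨fun j l hl => ?_, fun j l hl => ?_, fun j => ?_, fun j => ?_⟩
      · cases hc : t ⟨j, l, Nat.lt_of_succ_lt hl⟩
        · have := ht _ _ hc
          simp [this]
        · simp
      · cases hc : t ⟨j, l + 1, hl⟩
        · have := ht _ _ hc
          simp [this]
        · simp
      · have hr := finRotate_val j
        have hj := j.2
        have hj2 := i₂.2
        cases hc : t ⟨j, 0, hb j⟩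
        · have := ht _ _ hc
          simp only [upperLeft, Fin.lt_def, Fin.ext_iff, hr, ne_eq] at this ⊢
          simp only [Bool.false_eq_true, and_false, and_true, false_or, eq_iff_iff]
          split_ifs <;> omega
        · simp only [upperLeft, Fin.lt_def, Fin.ext_iff, hr]
          simp only [Bool.false_eq_true, Bool.true_eq_false, and_false, and_true, false_or,
            or_false, eq_iff_iff]
          split_ifs <;> omega
      · have hr := finRotate_val j
        have hj := j.2
        have hj2 := i₂.2
        cases hc : t (lowerRight hb (finRotate N j)).1
        · have := ht _ _ hc
          simp only [lowerRight, Fin.lt_def, Fin.ext_iff, hr, ne_eq] at this ⊢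
          simp only [Bool.true_eq_false, Bool.not_false, and_false, and_true, or_false,
            eq_iff_iff]
          split_ifs at this ⊢ <;> omega
        · simp only [lowerRight, Fin.lt_def, Fin.ext_iff, hr]
          simp only [Bool.false_eq_true, Bool.true_eq_false, Bool.not_true, and_false, and_true,
            false_or, or_false, eq_iff_iff]
          split_ifs <;> omega
    have := h _ hF (lowerRight hb i₁) (upperLeft hb i₁) (Or.inr (Or.inl ⟨rfl, rfl⟩))
    simp [upperLeft, hlt.ne] at this
  rcases lt_or_gt_of_ne hj with h3 | h3
  · exact key _ _ h3 hj0 hi₀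
  · exact key _ _ h3 hi₀ hj0

/-- Such a state amounts to a free choice of the horizontal crossing in each column other than `i₀`.
-/
theorem card_isUnicursal (i₀ : Fin N) :
    Nat.card {t : (Σ i, Fin (b i)) → Bool // IsUnicursal t i₀} =
      ∏ j ∈ Finset.univ.erase i₀, b j := by
  let f : (∀ j : {j // j ≠ i₀}, Fin (b j)) → {t : (Σ i, Fin (b i)) → Bool // IsUnicursal t i₀} :=
    fun g => ⟨fun x => if h : x.1 = i₀ then true else decide (x.2 ≠ g ⟨x.1, h⟩), by
      refine ⟨cuts_all_eq_zero.2 fun k => by simp, fun j hj =>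
        cuts_all_eq_one.2 ⟨g ⟨j, hj⟩, fun k => by simp [hj]⟩⟩⟩
  have hf : Function.Bijective f := by
    constructor
    · intro g g' h
      funext ⟨j, hj⟩
      have h2 := congrFun (congrArg Subtype.val h) ⟨j, g ⟨j, hj⟩⟩
      simpa [f, hj] using h2
    · rintro ⟨t, h0, h1⟩
      have h2 := fun j : {j // j ≠ i₀} => cuts_all_eq_one.1 (h1 j j.2)
      choose g hg using h2
      refine ⟨g, Subtype.ext (funext fun ⟨i, k⟩ => ?_)⟩
      by_cases hi : i = i₀
      · subst hi
        simp [f, cuts_all_eq_zero.1 h0]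
      · have := hg ⟨i, hi⟩ k
        simp only [f, hi, dite_false]
        by_cases hk : k = g ⟨i, hi⟩
        · rw [this.2 hk]; simp [hk]
        · rw [← this, Bool.not_eq_false] at hk
          rw [hk]
          simp only [decide_eq_true_eq]
          intro h3
          rw [this.2 h3] at hk
          cases hk
  rw [← Nat.card_eq_of_bijective f hf, Nat.card_pi]
  simp only [Nat.card_eq_fintype_card, Fintype.card_fin]
  exact (Finset.prod_subtype (Finset.univ.erase i₀) (by simp) b).symm

/-! ### Circles of a state that is constant on each column -/

/-- The circles obtained by splicing all crossings of the columns with `c i = true` vertically and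
all others horizontally: one to the right of each column of the first kind, and one between any two
consecutive crossings of a column of the second kind. -/
abbrev Circle (b : Fin N → ℕ) (c : Fin N → Bool) : Type :=
  {i // c i = true} ⊕ Σ j : {j // c j = false}, Fin (b j - 1)

variable {c : Fin N → Bool}

/-- `L i` is the last vertically spliced column before column `i`. -/
def IsPrevVertical (L : Fin N → {i // c i = true}) : Prop :=
  ∀ j, L (finRotate N j) = if h : c j = true then ⟨j, h⟩ else L j

theorem exists_isPrevVertical (h : ∃ i, c i = true) :
    ∃ L : Fin N → {i // c i = true}, IsPrevVertical L := by
  obtain ⟨i, hi⟩ := h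
  generalize hσ : finRotate N = σ
  -- The search goes backwards around the ring. It takes at least one step because column `j` does
  -- not precede itself, unless a full turn leads back to it.
  have hex : ∀ j, ∃ k, c (σ.symm^[k + 1] j) = true := by
    subst hσ
    refine finRotate_induction (finRotate N i) ⟨0, ?_⟩ ?_
    · rwa [zero_add, Function.iterate_one, Equiv.symm_apply_apply]
    · rintro j ⟨k, hk⟩
      exact ⟨k + 1, by rwa [Function.iterate_succ_apply, Equiv.symm_apply_apply]⟩
  refine ⟨fun j => ⟨_, Nat.find_spec (hex j)⟩, fun j => ?_⟩
  rw [hσ]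
  split_ifs with hj
  · have h0 : Nat.find (hex (σ j)) = 0 := by simpa using hj
    exact Subtype.ext ((congrArg (fun n => σ.symm^[n + 1] (σ j)) h0).trans (by simp))
  · have h0 : Nat.find (hex (σ j)) = Nat.find (hex j) + 1 := by
      rw [Nat.find_eq_iff]
      refine ⟨by simpa using Nat.find_spec (hex j), fun k hk => ?_⟩
      obtain _ | k := k
      · simpa using hj
      · have := Nat.find_min (hex j) (Nat.lt_of_succ_lt_succ hk)
        simpa using this
    exact Subtype.ext ((congrArg (fun n => σ.symm^[n + 1] (σ j)) h0).trans (by simp))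

/-- The circle that meets column `i` between its crossings number `k - 1` and `k`. -/
def node (L : Fin N → {i // c i = true}) (i : Fin N) (h : c i = false) (k : ℕ) : Circle b c :=
  -- The arcs above the first and below the last crossing of a horizontal column lie on the same
  -- circle `L i`, so the column becomes a closed cycle of edges.
  if h' : 0 < k ∧ k < b i then Sum.inr ⟨⟨i, h⟩, ⟨k - 1, by simp only; omega⟩⟩ else Sum.inl (L i)

/-- The circle through a dart. -/
def circleOf (L : Fin N → {i // c i = true}) (x : (Σ i, Fin (b i)) × Bool) : Circle b c :=
  if h : c x.1.1 = true then Sum.inl (if x.2 then ⟨x.1.1, h⟩ else L x.1.1)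
  else node L x.1.1 (by simpa using h) (x.1.2.1 + x.2.toNat)

theorem circleOf_vertical (L : Fin N → {i // c i = true}) {i : Fin N} (h : c i = true)
    (k : Fin (b i)) (e : Bool) :
    circleOf L (⟨i, k⟩, e) = Sum.inl (if e then ⟨i, h⟩ else L i) := by
  simp [circleOf, h]

theorem circleOf_horizontal (L : Fin N → {i // c i = true}) {i : Fin N} (h : c i = false)
    (k : Fin (b i)) (e : Bool) :
    circleOf L (⟨i, k⟩, e) = node L i h (k + e.toNat) := by
  simp [circleOf, h]

theorem node_zero (L : Fin N → {i // c i = true}) {i : Fin N} (h : c i = false) :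
    node (b := b) L i h 0 = Sum.inl (L i) := by simp [node]

theorem node_last (L : Fin N → {i // c i = true}) {i : Fin N} (h : c i = false) :
    node (b := b) L i h (b i) = Sum.inl (L i) := by simp [node]

theorem circleOf_upperLeft (hb : ∀ i, 0 < b i) (L : Fin N → {i // c i = true}) (i : Fin N) :
    circleOf L (upperLeft hb i) = Sum.inl (L i) := by
  cases h : c i
  · exact (circleOf_horizontal L h _ _).trans (node_zero L h)
  · exact circleOf_vertical L h _ _

theorem IsPrevVertical.of_true {L : Fin N → {i // c i = true}} (hL : IsPrevVertical L) {i : Fin N}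
    (h : c i = true) : L (finRotate N i) = ⟨i, h⟩ := by rw [hL, dif_pos h]

theorem IsPrevVertical.of_false {L : Fin N → {i // c i = true}} (hL : IsPrevVertical L) {i : Fin N}
    (h : c i = false) : L (finRotate N i) = L i := by rw [hL, dif_neg (by simp [h])]

theorem circleOf_lowerRight (hb : ∀ i, 0 < b i) {L : Fin N → {i // c i = true}}
    (hL : IsPrevVertical L) (i : Fin N) :
    circleOf L (lowerRight hb i) = Sum.inl (L (finRotate N i)) := by
  rw [lowerRight]
  rcases Bool.eq_false_or_eq_true (c i) with h | h
  · rw [circleOf_vertical L h, hL.of_true h]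
    rfl
  · have : b i - 1 + Bool.toNat true = b i := Nat.sub_add_cancel (hb i)
    rw [circleOf_horizontal L h, hL.of_false h]
    simp only [this, node_last]

theorem columnInvariant_circleOf (hb : ∀ i, 0 < b i) {L : Fin N → {i // c i = true}}
    (hL : IsPrevVertical L) : ColumnInvariant hb (fun x => c x.1) (circleOf L) := by
  refine ⟨fun j l hl => ?_, fun j l hl => ?_, fun j => ?_, fun j => ?_⟩
  · cases h : c j
    · simp [circleOf_horizontal L h]
    · simp [circleOf_vertical L h]
  · cases h : c j
    · simp [circleOf_horizontal L h]
    · simp [circleOf_vertical L h]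
  · rw [circleOf_upperLeft]
    rcases Bool.eq_false_or_eq_true (c j) with h | h
    · rw [circleOf_vertical L h, hL.of_true h]
      simp [h]
    · rw [circleOf_horizontal L h, node, dif_neg (by simp [h]), hL.of_false h]
  · rw [circleOf_lowerRight hb hL]
    generalize finRotate N j = i at *
    simp only [show (lowerRight hb i).1.1 = i from rfl]
    cases h : c i
    · rw [show ((lowerRight hb i).1, !false) = lowerRight hb i from rfl,
        circleOf_lowerRight hb hL, hL.of_false h]
    · exact (circleOf_vertical L h (lowerRight hb i).1.2 false).symm

/-- `circleOf` is the universal invariant: every `F` factors through it. Tops and bottoms of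
horizontal columns are traced back around the ring to the last vertical column. -/
theorem ColumnInvariant.eq_of_circleOf_eq {hb : ∀ i, 0 < b i} {L : Fin N → {i // c i = true}}
    (hL : IsPrevVertical L) {X : Type*} {F : (Σ i, Fin (b i)) × Bool → X}
    (hF : ColumnInvariant hb (fun x => c x.1) F) {x y : (Σ i, Fin (b i)) × Bool}
    (hxy : circleOf L x = circleOf L y) : F x = F y := by
  have hr : ∀ i (k : Fin (b i)), c i = true → F (⟨i, k⟩, true) = F (lowerRight hb i) :=
    fun i k h => hF.right_of_forall k.2 fun _ _ _ => h
  have hA0 : ∀ i, c i = true →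
      F (upperLeft hb (finRotate N i)) = F (lowerRight hb (L (finRotate N i))) := by
    intro i hi
    rw [hF.top, hL.of_true hi]
    simp only [hi]
    exact hr _ _ hi
  have hA : ∀ j, F (upperLeft hb j) = F (lowerRight hb (L j)) := by
    intro j₀
    refine finRotate_induction (P := fun j => F (upperLeft hb j) = F (lowerRight hb (L j)))
      (finRotate N (L j₀)) (hA0 _ (L j₀).2) (fun j hj => ?_) j₀
    cases h : c j
    · rw [hF.top, hL.of_false h]
      simp only [h]
      exact hj
    · exact hA0 j h
  have hB : ∀ j, F (lowerRight hb j) = F (lowerRight hb (L (finRotate N j))) := by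
    intro j₀
    have h0 : ∀ j, c j = true → F (lowerRight hb j) = F (lowerRight hb (L (finRotate N j))) :=
      fun j hj => by rw [hL.of_true hj]
    refine finRotate_induction
      (P := fun j => F (lowerRight hb j) = F (lowerRight hb (L (finRotate N j)))) (L j₀).1
      (h0 _ (L j₀).2) (fun j hj => ?_) j₀
    cases h : c (finRotate N j)
    · have h2 := hF.bottom j
      have h3 : c (lowerRight hb (finRotate N j)).1.1 = false := h
      simp only [h3, Bool.not_false] at h2
      rw [hL.of_false h, ← hj, h2]
      rfl
    · exact h0 _ h
  -- `G` evaluates `F` at one dart of each circle: the lower right end of a vertical column, or the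
  -- lower arc of the crossing just above the circle.
  let G : Circle b c → X := Sum.elim (fun i => F (lowerRight hb i))
    fun y => F (⟨y.1, y.2.1, y.2.2.trans_le (Nat.sub_le _ _)⟩, true)
  have hG : ∀ x, F x = G (circleOf L x) := by
    rintro ⟨⟨i, k, hk⟩, e⟩
    cases h : c i
    · rw [circleOf_horizontal L h]
      cases e
      · obtain _ | k := k
        · exact (hA i).trans (congrArg G (node_zero L h)).symm
        · rw [node, dif_pos (by simpa using hk), hF.down]
          simp [G, h]
      · by_cases hk' : k + 1 < b i
        · rw [node, dif_pos (by simpa using hk')]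
          simp [G]
        · obtain rfl : k = b i - 1 := by omega
          rw [node, dif_neg (by simp; omega)]
          refine (hB i).trans ?_
          rw [hL.of_false h]
          rfl
    · rw [circleOf_vertical L h]
      cases e
      · exact (hF.left_of_forall hk fun _ _ => h).trans (hA i)
      · exact hr i _ h
  rw [hG x, hG y, hxy]

theorem circleOf_surjective (hb : ∀ i, 0 < b i) {L : Fin N → {i // c i = true}} :
    Function.Surjective (circleOf (b := b) L) := by
  rintro (⟨i, hi⟩ | ⟨⟨j, hj⟩, k, hk⟩)
  · exact ⟨(⟨i, 0, hb i⟩, true), by rw [circleOf_vertical L hi]; rfl⟩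
  · simp only at hk
    refine ⟨(⟨j, k, by omega⟩, true), ?_⟩
    rw [circleOf_horizontal L hj, node, dif_pos (by simp; omega)]
    rfl

theorem card_circle (hb : ∀ i, 0 < b i) :
    (Nat.card (Circle b c) : ℤ) = ∑ i, if c i = true then 1 else (b i : ℤ) - 1 := by
  rw [Nat.card_sum, Nat.card_sigma, Finset.sum_ite]
  simp only [Nat.card_eq_fintype_card, Fintype.card_fin, Fintype.card_subtype]
  push_cast
  congr 1
  · simp
  · rw [Finset.sum_subtype (Finset.univ.filter fun i => ¬ c i = true) (p := fun i => c i = false)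
      (by simp)]
    exact Finset.sum_congr rfl fun i _ => by have := hb i; push_cast [Nat.cast_sub (hb i)]; rfl

/-! ### Spanning trees of the graph of circles -/

/-- The circles `u` and `v` are joined by an edge from `T`. -/
def JoinedIn (L : Fin N → {i // c i = true}) (T : Set (Σ i, Fin (b i))) (u v : Circle b c) : Prop :=
  ∃ x : (Σ i, Fin (b i)) × Bool, x.1 ∈ T ∧ circleOf L x = u ∧ circleOf L (x.1, !x.2) = v

/-- `T` is the edge set of a spanning tree of the graph of circles. -/
def IsTree (L : Fin N → {i // c i = true}) (T : Set (Σ i, Fin (b i))) : Prop :=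
  (∀ u v, Relation.ReflTransGen (JoinedIn L T) u v) ∧ T.ncard + 1 = Nat.card (Circle b c)

/-- A predicate preserved by the edges of `T` is a union of components. For the converse, take
reachability from `u`. -/
theorem forall_reflTransGen_joinedIn_iff {L : Fin N → {i // c i = true}}
    {T : Set (Σ i, Fin (b i))} :
    (∀ u v, Relation.ReflTransGen (JoinedIn L T) u v) ↔
    ∀ P : Circle b c → Prop, (∀ x ∈ T, P (circleOf L (x, false)) ↔ P (circleOf L (x, true))) →
      ∀ u v, P u → P v := by
  constructor
  · intro h P hP u v hu
    have huv := h u v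
    induction huv with
    | refl => exact hu
    | tail _ hj ih =>
      obtain ⟨⟨x, e⟩, hx, rfl, rfl⟩ := hj
      cases e
      · exact (hP x hx).1 ih
      · exact (hP x hx).2 ih
  · intro h u v
    refine h (Relation.ReflTransGen (JoinedIn L T) u) (fun x hx => ⟨fun h1 => ?_, fun h1 => ?_⟩)
      u v .refl
    · exact h1.tail ⟨(x, false), hx, rfl, rfl⟩
    · exact h1.tail ⟨(x, true), hx, rfl, rfl⟩

open Classical in
/-- The state that has vertical splicings precisely at the crossings of `T` in the columns with
`c i = false` and at the crossings outside of `T` in the columns with `c i = true`. -/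
noncomputable def stateOf (c : Fin N → Bool) (T : Set (Σ i, Fin (b i))) : (Σ i, Fin (b i)) → Bool :=
  -- The splicing `c` is switched exactly along `T`.
  fun x => decide (x ∈ T) ^^ c x.1

theorem mem_iff_stateOf {T : Set (Σ i, Fin (b i))} {i : Fin N} {k : Fin (b i)} :
    ⟨i, k⟩ ∈ T ↔ stateOf c T ⟨i, k⟩ = !c i := by
  classical
  by_cases h : (⟨i, k⟩ : Σ i, Fin (b i)) ∈ T <;> simp [stateOf, h]

theorem cuts_all_eq_sum (t : (Σ i, Fin (b i)) → Bool) (i : Fin N) :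
    (cuts t i (b i) : ℤ) = ∑ k, if t ⟨i, k⟩ then 0 else 1 := by
  rw [cuts_all, Finset.card_filter, Nat.cast_sum]
  refine Finset.sum_congr rfl fun k _ => ?_
  cases t ⟨i, k⟩ <;> simp

theorem ncard_eq_sum_cuts (T : Set (Σ i, Fin (b i))) :
    (T.ncard : ℤ) = ∑ i, if c i = true then (cuts (stateOf c T) i (b i) : ℤ)
      else b i - cuts (stateOf c T) i (b i) := by
  classical
  have hT : T.toFinset = Finset.univ.filter (· ∈ T) := by ext; simp
  rw [Set.ncard_eq_toFinset_card', hT, Finset.card_filter,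
    Nat.cast_sum, Fintype.sum_sigma]
  refine Finset.sum_congr rfl fun i _ => ?_
  rw [cuts_all_eq_sum]
  cases h : c i
  · rw [if_neg Bool.false_ne_true, eq_sub_iff_add_eq, ← Finset.sum_add_distrib]
    trans ∑ k : Fin (b i), (1 : ℤ)
    · refine Finset.sum_congr rfl fun k _ => ?_
      by_cases h2 : (⟨i, k⟩ : Σ i, Fin (b i)) ∈ T <;> simp [stateOf, h, h2]
    · simp
  · rw [if_pos rfl]
    refine Finset.sum_congr rfl fun k _ => ?_
    by_cases h2 : (⟨i, k⟩ : Σ i, Fin (b i)) ∈ T <;> simp [stateOf, h, h2]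

/-- The number of edges of `T` has the value for a spanning tree. -/
theorem ncard_add_one_eq_iff (hb : ∀ i, 0 < b i) {T : Set (Σ i, Fin (b i))} :
    T.ncard + 1 = Nat.card (Circle b c) ↔
    -- Edges of `T` minus circles, column by column: a vertical column has one circle and a
    -- horizontal one has `b i - 1`.
    ∑ i, (if c i = true then (cuts (stateOf c T) i (b i) : ℤ) - 1
      else 1 - cuts (stateOf c T) i (b i)) = -1 := by
  rw [← Nat.cast_inj (R := ℤ), Nat.cast_add, ncard_eq_sum_cuts (c := c), card_circle hb,
    ← sub_eq_zero, eq_neg_iff_add_eq_zero, add_sub_right_comm, ← Finset.sum_sub_distrib]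
  refine Eq.congr (congrArg (· + _) (Finset.sum_congr rfl fun i _ => ?_)) rfl
  split_ifs <;> ring

/-- `T` has one edge of each parallel bundle except that of `i₀`, which makes a path through the
ring, and it omits just one edge of each attached cycle. -/
theorem reflTransGen_of_isUnicursal {L : Fin N → {i // c i = true}}
    (hL : IsPrevVertical L) {T : Set (Σ i, Fin (b i))} {i₀ : Fin N} (hi₀ : c i₀ = true)
    (hu : IsUnicursal (stateOf c T) i₀) (u v : Circle b c) :
    Relation.ReflTransGen (JoinedIn L T) u v := by
  revert u v
  rw [forall_reflTransGen_joinedIn_iff]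
  intro P hP
  have hinl : ∀ j, P (Sum.inl (L j)) ↔ P (Sum.inl ⟨i₀, hi₀⟩) := by
    refine finRotate_induction (finRotate N i₀) (by rw [hL.of_true hi₀]) fun j hj => ?_
    rcases Bool.eq_false_or_eq_true (c j) with h | h
    · rw [hL.of_true h]
      by_cases hji : j = i₀
      · subst hji; rfl
      · obtain ⟨k, hk⟩ := cuts_all_eq_one.1 (hu.2 j hji)
        have hkT : (⟨j, k⟩ : Σ i, Fin (b i)) ∈ T := by
          rw [mem_iff_stateOf (c := c), (hk k).2 rfl, h]; rfl
        have := hP _ hkT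
        rw [circleOf_vertical L h, circleOf_vertical L h] at this
        exact this.symm.trans hj
    · rwa [hL.of_false h]
  suffices ∀ u, P u ↔ P (Sum.inl ⟨i₀, hi₀⟩) from fun u v h => (this v).2 ((this u).1 h)
  rintro (⟨i, hi⟩ | ⟨⟨j, hj⟩, k⟩)
  · have := hinl (finRotate N i)
    rwa [hL.of_true hi] at this
  · have hji : j ≠ i₀ := by rintro rfl; rw [hi₀] at hj; cases hj
    obtain ⟨h, hh⟩ := cuts_all_eq_one.1 (hu.2 j hji)
    have hstep : ∀ l : ℕ, ∀ hl : l < b j, l ≠ h.1 →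
        (P (node L j hj l) ↔ P (node L j hj (l + 1))) := by
      intro l hl hne
      have hT : (⟨j, l, hl⟩ : Σ i, Fin (b i)) ∈ T := by
        rw [mem_iff_stateOf (c := c), hj, Bool.not_false, ← Bool.not_eq_false, hh]
        exact fun e => hne (congrArg Fin.val e)
      have := hP _ hT
      rwa [circleOf_horizontal L hj, circleOf_horizontal L hj] at this
    have hlow : ∀ l : ℕ, l ≤ h.1 → (P (node L j hj l) ↔ P (Sum.inl (L j))) := by
      intro l hl
      induction l with
      | zero => rw [node_zero]
      | succ l ih => rw [← hstep l (by have := h.2; omega) (by omega)]; exact ih (by omega)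
    have hhigh : ∀ l : ℕ, h.1 < l → l ≤ b j → (P (node L j hj l) ↔ P (Sum.inl (L j))) := by
      intro l hl hlb
      revert hl
      induction hlb using Nat.decreasingInduction with
      | self => intro _; rw [node_last]
      | of_succ l hlb ih => intro hl; rw [hstep l hlb (by omega)]; exact ih (by omega)
    have hk := k.2
    simp only at hk
    have hnode : node L j hj (k.1 + 1) = Sum.inr ⟨⟨j, hj⟩, k⟩ := by
      rw [node, dif_pos (by omega)]; rfl
    rw [← hnode, ← hinl j]
    rcases le_or_gt (k.1 + 1) h.1 with h3 | h3
    · exact hlow _ h3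
    · exact hhigh _ h3 (by omega)

/-- Two edges missing from an attached cycle would isolate the circles between the first and the
second one. -/
theorem cuts_le_one_of_reflTransGen {L : Fin N → {i // c i = true}}
    {T : Set (Σ i, Fin (b i))} (h : ∀ u v : Circle b c, Relation.ReflTransGen (JoinedIn L T) u v)
    {j : Fin N} (hj : c j = false) : cuts (stateOf c T) j (b j) ≤ 1 := by
  by_contra! hc
  obtain ⟨k, hk, -, h1⟩ := exists_cuts_eq_one hc.le
  rw [forall_reflTransGen_joinedIn_iff] at h
  let P : Circle b c → Prop := Sum.elim (fun _ => False)
    fun y => y.1.1 = j ∧ cuts (stateOf c T) j (y.2.1 + 1) = 1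
  have hnode : ∀ i (hi : c i = false) l, l ≤ b i →
      (P (node L i hi l) ↔ i = j ∧ cuts (stateOf c T) j l = 1) := by
    intro i hi l hl
    by_cases h2 : 0 < l ∧ l < b i
    · rw [node, dif_pos h2]
      simp only [P, Sum.elim_inr, Nat.sub_add_cancel h2.1]
    · rw [node, dif_neg h2]
      simp only [P, Sum.elim_inl, false_iff, not_and]
      rintro rfl
      rcases Nat.eq_zero_or_pos l with rfl | h3
      · rw [cuts_zero]; omega
      · obtain rfl : l = b i := by omega
        omega
  have hP : ∀ x ∈ T, P (circleOf L (x, false)) ↔ P (circleOf L (x, true)) := by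
    rintro ⟨i, l⟩ hx
    rcases Bool.eq_false_or_eq_true (c i) with hi | hi
    · rw [circleOf_vertical L hi, circleOf_vertical L hi]
      simp [P]
    · rw [circleOf_horizontal L hi, circleOf_horizontal L hi, hnode _ _ _ (by simp),
        hnode _ _ _ (by simp)]
      refine and_congr_right fun hij => ?_
      subst hij
      have h3 := cuts_succ (stateOf c T) i l.2
      rw [mem_iff_stateOf (c := c), hi] at hx
      rw [if_pos (by simpa using hx)] at h3
      simp only [Bool.toNat_false, Bool.toNat_true, h3, add_zero]
  have := h P hP (node L j hj (k + 1)) (Sum.inl (L j)) ((hnode _ _ _ hk).2 ⟨rfl, h1⟩)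
  exact this

/-- Two empty bundles would break the ring into two pieces. `Q` selects the ring circles between
them, each being indexed by the column to its left. -/
theorem eq_of_cuts_eq_zero_of_reflTransGen {L : Fin N → {i // c i = true}}
    (hL : IsPrevVertical L) {T : Set (Σ i, Fin (b i))}
    (h : ∀ u v : Circle b c, Relation.ReflTransGen (JoinedIn L T) u v) {i₁ i₂ : Fin N}
    (hc₁ : c i₁ = true) (hc₂ : c i₂ = true) (h₁ : cuts (stateOf c T) i₁ (b i₁) = 0)
    (h₂ : cuts (stateOf c T) i₂ (b i₂) = 0) : i₁ = i₂ := by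
  wlog hlt : i₁ < i₂ generalizing i₁ i₂
  · rcases lt_or_eq_of_le (not_lt.1 hlt) with h3 | h3
    · exact (this hc₂ hc₁ h₂ h₁ h3).symm
    · exact h3.symm
  exfalso
  rw [cuts_all_eq_zero] at h₁ h₂
  rw [forall_reflTransGen_joinedIn_iff] at h
  have hlt' : i₁.1 < i₂.1 := hlt
  let Q : Fin N → Prop := fun i => i₁.1 ≤ i.1 ∧ i.1 < i₂.1
  have hQ0 : ∀ i, c i = true → (Q (L (finRotate N i)) ↔
      i₁.1 < (finRotate N i).1 ∧ (finRotate N i).1 ≤ i₂.1) := by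
    intro i hi
    have := i.2
    have := i₂.2
    rw [hL.of_true hi, finRotate_val]
    simp only [Q]
    split_ifs <;> omega
  have hQ : ∀ j, Q (L j) ↔ i₁.1 < j.1 ∧ j.1 ≤ i₂.1 := by
    refine finRotate_induction (finRotate N i₁) (hQ0 _ hc₁) fun j hj => ?_
    rcases Bool.eq_false_or_eq_true (c j) with hc | hc
    · exact hQ0 _ hc
    · have hj1 : j.1 ≠ i₁.1 := fun e => by rw [Fin.ext e, hc₁] at hc; cases hc
      have hj2 : j.1 ≠ i₂.1 := fun e => by rw [Fin.ext e, hc₂] at hc; cases hc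
      have := j.2
      have := i₂.2
      rw [hL.of_false hc, hj, finRotate_val]
      split_ifs <;> omega
  let P : Circle b c → Prop := Sum.elim (fun i => Q i) fun y => Q (L y.1.1)
  have hnode : ∀ i (hi : c i = false) l, P (node L i hi l) ↔ Q (L i) := by
    intro i hi l
    rw [node]
    split_ifs <;> rfl
  have hP : ∀ x ∈ T, P (circleOf L (x, false)) ↔ P (circleOf L (x, true)) := by
    rintro ⟨i, l⟩ hx
    rw [mem_iff_stateOf (c := c)] at hx
    rcases Bool.eq_false_or_eq_true (c i) with hi | hi
    · have hj1 : i.1 ≠ i₁.1 := fun e => by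
        obtain rfl := Fin.ext e
        rw [h₁, hi] at hx; cases hx
      have hj2 : i.1 ≠ i₂.1 := fun e => by
        obtain rfl := Fin.ext e
        rw [h₂, hi] at hx; cases hx
      rw [circleOf_vertical L hi, circleOf_vertical L hi]
      refine (hQ i).trans ?_
      simp only [P, Q, if_true, Sum.elim_inl]
      omega
    · rw [circleOf_horizontal L hi, circleOf_horizontal L hi, hnode, hnode]
  have := h P hP (Sum.inl ⟨i₁, hc₁⟩) (Sum.inl ⟨i₂, hc₂⟩) ⟨le_rfl, hlt⟩
  exact lt_irrefl _ this.2

/-- `T` is a spanning tree precisely if the corresponding state is unicursal with respect to one of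
the columns with `c i = true`. -/
theorem isTree_iff (hb : ∀ i, 0 < b i) {L : Fin N → {i // c i = true}} (hL : IsPrevVertical L)
    {T : Set (Σ i, Fin (b i))} :
    IsTree L T ↔ ∃ i : {i // c i = true}, IsUnicursal (stateOf c T) i := by
  rw [IsTree, ncard_add_one_eq_iff hb]
  constructor
  · rintro ⟨h, hs⟩
    have hle := fun j (hj : c j = false) => cuts_le_one_of_reflTransGen h hj
    have huniq := fun i j hi hj => eq_of_cuts_eq_zero_of_reflTransGen hL h (i₁ := i) (i₂ := j)
      hi hj
    -- A term of this sum is negative only at an uncut vertical column, where it is `-1`, and there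
    -- is at most one such column. A total of `-1` therefore forces one such column and zero
    -- everywhere else.
    set d : Fin N → ℤ := fun i => if c i = true then (cuts (stateOf c T) i (b i) : ℤ) - 1
      else 1 - cuts (stateOf c T) i (b i) with hd
    change ∑ i, d i = -1 at hs
    have hd0 : ∀ i, (c i = true → cuts (stateOf c T) i (b i) ≠ 0) → 0 ≤ d i := by
      intro i hi
      simp only [hd]
      split_ifs with hci
      · have := hi hci; omega
      · have := hle i (by simpa using hci); omega
    obtain ⟨i₀, hci₀, h0⟩ : ∃ i, c i = true ∧ cuts (stateOf c T) i (b i) = 0 := by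
      by_contra! hcon
      have := Finset.sum_nonneg fun i (_ : i ∈ Finset.univ) => hd0 i (hcon i)
      omega
    refine ⟨⟨i₀, hci₀⟩, h0, fun j hj => ?_⟩
    have hd1 : ∀ j ∈ Finset.univ.erase i₀, 0 ≤ d j := fun j hj => hd0 j fun hcj hj0 =>
      (Finset.ne_of_mem_erase hj) (huniq _ _ hcj hci₀ hj0 h0)
    have hd2 : d i₀ = -1 := by simp [hd, hci₀, h0]
    rw [← Finset.add_sum_erase _ _ (Finset.mem_univ i₀), hd2, add_eq_left,
      Finset.sum_eq_zero_iff_of_nonneg hd1] at hs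
    have := hs j (by simpa using hj)
    simp only [hd] at this
    split_ifs at this <;> omega
  · rintro ⟨⟨i₀, hi₀⟩, hu⟩
    refine ⟨reflTransGen_of_isUnicursal hL hi₀ hu, ?_⟩
    rw [Finset.sum_eq_single i₀]
    · simp [hi₀, hu.1]
    · intro j _ hj
      simp [hu.2 j hj]
    · simp

theorem stateOf_bijective (c : Fin N → Bool) : Function.Bijective (stateOf (b := b) c) := by
  constructor
  · intro T T' h
    ext ⟨i, k⟩
    rw [mem_iff_stateOf (c := c), mem_iff_stateOf (c := c), h]
  · intro t
    refine ⟨{x | t x = !c x.1}, funext fun x => ?_⟩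
    cases h : c x.1 <;> simp [stateOf, h]

theorem card_exists_isUnicursal (c : Fin N → Bool) :
    Nat.card {t : (Σ i, Fin (b i)) → Bool // ∃ i : {i // c i = true}, IsUnicursal t i} =
      ∑ i with c i = true, ∏ j ∈ Finset.univ.erase i, b j := by
  let f : (Σ i : {i // c i = true}, {t : (Σ i, Fin (b i)) → Bool // IsUnicursal t i}) →
      {t : (Σ i, Fin (b i)) → Bool // ∃ i : {i // c i = true}, IsUnicursal t i} :=
    fun x => ⟨x.2.1, x.1, x.2.2⟩
  have hf : Function.Bijective f := by
    constructor
    · rintro ⟨i, t, ht⟩ ⟨i', t', ht'⟩ h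
      obtain rfl : t = t' := congrArg Subtype.val h
      obtain rfl : i = i' := Subtype.ext (ht.unique ht')
      rfl
    · rintro ⟨t, i, ht⟩
      exact ⟨⟨i, t, ht⟩, rfl⟩
  rw [← Nat.card_eq_of_bijective f hf, Nat.card_sigma]
  simp only [card_isUnicursal]
  exact (Finset.sum_subtype (Finset.univ.filter fun i => c i = true) (by simp)
    fun i => ∏ j ∈ Finset.univ.erase i, b j).symm

theorem card_isTree (hb : ∀ i, 0 < b i) {L : Fin N → {i // c i = true}} (hL : IsPrevVertical L) :
    Nat.card {T : Set (Σ i, Fin (b i)) // IsTree L T} =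
      ∑ i with c i = true, ∏ j ∈ Finset.univ.erase i, b j := by
  rw [← card_exists_isUnicursal]
  exact Nat.card_congr ((Equiv.ofBijective _ (stateOf_bijective c)).subtypeEquiv
    fun T => isTree_iff hb hL)

end TwistColumns

/-! ### Models for the cycles of a permutation, and dessins -/

theorem Equiv.Perm.SameCycle.apply_eq {α X : Type*} {f : Equiv.Perm α} {F : α → X}
    (hF : ∀ x, F (f x) = F x) {x y : α} (h : f.SameCycle x y) : F x = F y := by
  obtain ⟨k, rfl⟩ := h
  have hn : ∀ (n : ℕ) x, F ((f ^ n) x) = F x := fun n => by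
    induction n with
    | zero => simp
    | succ n ih => intro x; rw [pow_succ, Equiv.Perm.mul_apply, ih, hF]
  obtain ⟨n, rfl | rfl⟩ := k.eq_nat_or_neg
  · rw [zpow_natCast, hn]
  · have := hn n ((f ^ n)⁻¹ x)
    rw [← Equiv.Perm.mul_apply, mul_inv_cancel, Equiv.Perm.one_apply] at this
    rw [zpow_neg, zpow_natCast, this]

/-- If the fibres of a surjection are the cycles of a permutation, its target can serve as the set of
cycles. -/
noncomputable def Equiv.Perm.cyclesEquiv {α X : Type*} {f : Equiv.Perm α} {F : α → X}
    (hF : ∀ x y, f.SameCycle x y ↔ F x = F y) (hs : Function.Surjective F) :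
    Quotient (Equiv.Perm.SameCycle.setoid f) ≃ X :=
  Equiv.ofBijective (Quotient.lift F fun x y h => (hF x y).1 h)
    ⟨fun u v => Quotient.inductionOn₂ u v fun x y h => Quotient.sound ((hF x y).2 h),
      fun z => (hs z).imp' (Quotient.mk _) fun _ h => h⟩

namespace Dessin

/-- Spanning trees in terms of models of the sets of vertices and edges. -/
theorem numSpanningTrees_eq (D : Dessin) {X C : Type} {F : D.Dart → X} {e : D.Dart → C}
    (hF : ∀ x y, D.rot.SameCycle x y ↔ F x = F y) (hFs : Function.Surjective F)
    (he : ∀ x y, D.flip.SameCycle x y ↔ e x = e y) (hes : Function.Surjective e) :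
    D.numSpanningTrees = Nat.card {T : Set C //
      (∀ u v, Relation.ReflTransGen (fun u v => ∃ h, e h ∈ T ∧ F h = u ∧ F (D.flip h) = v) u v) ∧
        T.ncard + 1 = Nat.card X} := by
  let φ : D.Vertex ≃ X := Equiv.Perm.cyclesEquiv hF hFs
  let ψ : D.Edge ≃ C := Equiv.Perm.cyclesEquiv he hes
  have hφ : ∀ h, φ (D.vertexOf h) = F h := fun h => rfl
  have hψ : ∀ h, ψ (D.edgeOf h) = e h := fun h => rfl
  refine Nat.card_congr ((Equiv.Set.congr ψ).subtypeEquiv fun T => ?_)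
  refine and_congr ?_ ?_
  · have h1 : ∀ u v, D.AdjIn T u v ↔
        ∃ h, e h ∈ ψ '' T ∧ F h = φ u ∧ F (D.flip h) = φ v := by
      intro u v
      refine exists_congr fun h => ?_
      rw [← hφ, ← hφ, ← hψ, φ.injective.eq_iff, φ.injective.eq_iff,
        ψ.injective.mem_set_image]
    constructor
    · intro h u v
      have h2 : Relation.ReflTransGen (fun u v => ∃ h, e h ∈ ψ '' T ∧ F h = u ∧
          F (D.flip h) = v) (φ (φ.symm u)) (φ (φ.symm v)) :=
        Relation.ReflTransGen.lift φ (fun _ _ hab => (h1 _ _).1 hab) _ _ (h _ _)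
      rwa [φ.apply_symm_apply, φ.apply_symm_apply] at h2
    · intro h u v
      have h2 : Relation.ReflTransGen (D.AdjIn T) (φ.symm (φ u)) (φ.symm (φ v)) :=
        Relation.ReflTransGen.lift φ.symm (fun a b hab => (h1 _ _).2 (by
          rw [φ.apply_symm_apply, φ.apply_symm_apply]; exact hab)) _ _ (h _ _)
      rwa [φ.symm_apply_apply, φ.symm_apply_apply] at h2
  · rw [Equiv.Set.congr_apply, Set.ncard_image_of_injective _ ψ.injective, Nat.card_congr φ]

/-- The hypothesis is applied to the quotient map onto the components. -/
theorem card_component_eq_one (D : Dessin) (hne : Nonempty D.Dart)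
    (h : ∀ (X : Type) (F : D.Dart → X), (∀ x, F (D.rot x) = F x) → (∀ x, F (D.flip x) = F x) →
      ∀ x y, F x = F y) : Nat.card D.Component = 1 := by
  rw [Nat.card_eq_one_iff_unique]
  refine ⟨⟨fun u v => Quotient.inductionOn₂ u v fun x y => ?_⟩,
    hne.map (Quotient.mk (MulAction.orbitRel (Subgroup.closure {D.rot, D.flip}) D.Dart))⟩
  refine h _ (Quotient.mk (MulAction.orbitRel (Subgroup.closure {D.rot, D.flip}) D.Dart))
    (fun x => Quotient.sound ?_) (fun x => Quotient.sound ?_) x y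
  · exact ⟨⟨D.rot, Subgroup.subset_closure (by simp)⟩, rfl⟩
  · exact ⟨⟨D.flip, Subgroup.subset_closure (by simp)⟩, rfl⟩

end Dessin

namespace TwistColumns

/-- `E` stands for the edge permutation of the pretzel diagram and enters only through these four
equations. -/
theorem columnInvariant_iff {N : ℕ} {b : Fin N → ℕ} {hb : ∀ i, 0 < b i}
    {t : (Σ i, Fin (b i)) → Bool} {X : Type*}
    {F : (Σ i, Fin (b i)) × Bool → X} {E : (Σ i, Fin (b i)) × Bool → (Σ i, Fin (b i)) × Bool}
    (hdown : ∀ i k (h : k + 1 < b i),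
      E (⟨i, k, Nat.lt_of_succ_lt h⟩, false) = (⟨i, k + 1, h⟩, false))
    (hbottom : ∀ i, E ((lowerRight hb i).1, false) = lowerRight hb ((finRotate N).symm i))
    (hup : ∀ i k (h : k + 1 < b i),
      E (⟨i, k + 1, h⟩, true) = (⟨i, k, Nat.lt_of_succ_lt h⟩, true))
    (htop : ∀ i, E (⟨i, 0, hb i⟩, true) = upperLeft hb (finRotate N i)) :
    (∀ x, F (E (x, false)) = F (x, !t x) ∧ F (E (x, true)) = F (x, t x)) ↔
      ColumnInvariant hb t F := by
  constructor
  · intro h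
    refine ⟨fun i k hk => ?_, fun i k hk => ?_, fun i => ?_, fun i => ?_⟩
    · rw [← (h _).1, hdown]
    · rw [← (h _).2, hup]
    · rw [← (h _).2, htop]
    · rw [← (h _).1, hbottom, Equiv.symm_apply_apply]
  · rintro h ⟨i, k, hk⟩
    constructor
    · by_cases hk' : k + 1 < b i
      · rw [hdown i k hk', h.down]
      · obtain rfl : k = b i - 1 := by omega
        have h2 := h.bottom ((finRotate N).symm i)
        rw [Equiv.apply_symm_apply, ← hbottom] at h2
        exact h2
    · obtain _ | k := k
      · rw [htop, h.top]
      · rw [hup i k hk, h.up]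

end TwistColumns

/-! ### The dessin of a pretzel diagram: circles, trees, genus -/

namespace LinkDiagram

open TwistColumns

theorem sameCycle_opp {C : Type} {x y : C × Bool} : (opp C).SameCycle x y ↔ x.1 = y.1 := by
  constructor
  · exact Equiv.Perm.SameCycle.apply_eq fun _ => rfl
  · obtain ⟨x, e⟩ := x
    obtain ⟨y, e'⟩ := y
    rintro (rfl : x = y)
    by_cases h : e = e'
    · rw [h]
    · refine ⟨1, ?_⟩
      cases e <;> cases e' <;> simp_all [opp]

theorem turn_mul_opp (D : LinkDiagram) (s : D.State) :
    D.turn s * opp D.Crossing = D.turn fun c => !s c := by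
  ext ⟨c, e⟩ : 1
  by_cases h : s c = D.inOver c
  · simp [turn, opp, h]
  · simp [turn, opp, h]

section Pretzel

variable {N : ℕ} {a : Fin N → ℤ} (ha : ∀ i, a i ≠ 0)

theorem natAbs_pos_of_ne (ha : ∀ i, a i ≠ 0) (i : Fin N) : 0 < (a i).natAbs :=
  Int.natAbs_pos.2 (ha i)

/-- The crossings that are spliced vertically in a state. -/
def vertical (a : Fin N → ℤ) (s : (Σ i, Fin (a i).natAbs) → Bool) :
    (Σ i, Fin (a i).natAbs) → Bool := fun x => s x ^^ decide (a x.1 < 0)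

theorem invariant_iff_columnInvariant {s : (pretzel a ha).State} {X : Type*}
    {F : (Σ i, Fin (a i).natAbs) × Bool → X} :
    (∀ x, F (((pretzel a ha).edge * (pretzel a ha).turn s) x) = F x) ↔
      ColumnInvariant (natAbs_pos_of_ne ha) (vertical a s) F := by
  -- A vertical splicing joins the two left ends and the two right ends, that is `in e` with `out
  -- e`; a horizontal one joins `in e` with `out !e`.
  have hturn : ∀ x e, (pretzel a ha).turn s (x, e) = (x, e == vertical a s x) := by
    intro x e
    change (x, if s x = decide (a x.1 < 0) then !e else e) = (x, e == (s x ^^ decide (a x.1 < 0)))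
    cases s x <;> cases decide (a x.1 < 0) <;> cases e <;> rfl
  have h1 : (∀ x, F (((pretzel a ha).edge * (pretzel a ha).turn s) x) = F x) ↔
      ∀ x, F ((pretzel a ha).edge (x, false)) = F (x, !vertical a s x) ∧
        F ((pretzel a ha).edge (x, true)) = F (x, vertical a s x) := by
    constructor
    · intro h x
      have h2 := h (x, false)
      have h3 := h (x, true)
      simp only [Equiv.Perm.mul_apply] at h2 h3
      rw [hturn] at h2 h3
      revert h2 h3
      cases vertical a s x
      · exact fun h2 h3 => ⟨h3, h2⟩
      · exact fun h2 h3 => ⟨h2, h3⟩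
    · rintro h ⟨x, e⟩
      obtain ⟨h2, h3⟩ := h x
      rw [Equiv.Perm.mul_apply, hturn]
      revert h2 h3
      cases vertical a s x <;> cases e
      · exact fun h2 h3 => h3
      · exact fun h2 h3 => h2
      · exact fun h2 h3 => h2
      · exact fun h2 h3 => h3
  refine h1.trans (columnInvariant_iff (E := (pretzel a ha).edge) (fun i k h => dif_pos h)
    (fun i => dif_neg (by have := natAbs_pos_of_ne ha i; simp only; omega)) (fun i k h =>
      if_pos (e := upperLeft (natAbs_pos_of_ne ha) (finRotate N i)) (Nat.succ_pos k)) fun i => ?_)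
  exact if_neg (t := (⟨i, ⟨0 - 1, (Nat.sub_le _ _).trans_lt (natAbs_pos_of_ne ha i)⟩⟩, true))
    (lt_irrefl (0 : ℕ))

/-- The quotient map onto the cycles is itself an invariant, hence factors through `circleOf`. -/
theorem dessin_sameCycle_iff {s : (pretzel a ha).State} {c : Fin N → Bool}
    (hs : ∀ x, vertical a s x = c x.1) {L : Fin N → {i // c i = true}} (hL : IsPrevVertical L)
    (x y : (Σ i, Fin (a i).natAbs) × Bool) :
    ((pretzel a ha).edge * (pretzel a ha).turn s).SameCycle x y ↔ circleOf L x = circleOf L y := by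
  have hs' : vertical a s = fun x => c x.1 := funext hs
  constructor
  · refine Equiv.Perm.SameCycle.apply_eq ((invariant_iff_columnInvariant ha).2 ?_)
    rw [hs']
    exact columnInvariant_circleOf _ hL
  · intro h
    let S := Equiv.Perm.SameCycle.setoid ((pretzel a ha).edge * (pretzel a ha).turn s)
    have hF : ColumnInvariant (natAbs_pos_of_ne ha) (vertical a s) (Quotient.mk S) :=
      (invariant_iff_columnInvariant ha).1 fun x =>
        Quotient.sound (Equiv.Perm.SameCycle.symm ⟨1, by simp⟩)
    rw [hs'] at hF
    exact Quotient.exact (hF.eq_of_circleOf_eq hL h)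

theorem numCircles_eq_one_iff (hN : 0 < N) (s : (pretzel a ha).State) :
    (pretzel a ha).numCircles s = 1 ↔ ∃ i, IsUnicursal (vertical a s) i := by
  let S := Equiv.Perm.SameCycle.setoid ((pretzel a ha).edge * (pretzel a ha).turn s)
  have hb := natAbs_pos_of_ne ha
  change Nat.card (Quotient S) = 1 ↔ _
  rw [Nat.card_eq_one_iff_unique]
  constructor
  · rintro ⟨h, -⟩
    refine exists_isUnicursal hb hN fun F hF x y hx => ?_
    have hxy : Quotient.mk S x = Quotient.mk S y := Subsingleton.elim _ _
    have := Equiv.Perm.SameCycle.apply_eq ((invariant_iff_columnInvariant ha).2 hF)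
      (Quotient.exact hxy)
    rwa [← this]
  · rintro ⟨i, hi⟩
    have hF : ColumnInvariant hb (vertical a s) (Quotient.mk S) :=
      (invariant_iff_columnInvariant ha).1 fun x =>
        Quotient.sound (Equiv.Perm.SameCycle.symm ⟨1, by simp⟩)
    exact ⟨⟨fun u v => Quotient.inductionOn₂ u v fun x y => hi.eq hF x y⟩,
      ⟨Quotient.mk S (upperLeft hb i)⟩⟩

theorem numCircles_pos (hN : 0 < N) (s : (pretzel a ha).State) :
    0 < (pretzel a ha).numCircles s := by
  let S := Equiv.Perm.SameCycle.setoid ((pretzel a ha).edge * (pretzel a ha).turn s)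
  have hd : Finite ((pretzel a ha).Crossing × Bool) := inferInstance
  have h1 : Finite (Quotient S) := Quotient.finite S
  have h2 : Nonempty (Quotient S) := ⟨Quotient.mk S (upperLeft (natAbs_pos_of_ne ha) ⟨0, hN⟩)⟩
  exact Nat.card_pos (α := Quotient S)

theorem vertical_true (x : Σ i, Fin (a i).natAbs) :
    vertical a (fun _ => true) x = !decide (a x.1 < 0) := by
  rw [vertical, Bool.true_xor]

theorem vertical_false (x : Σ i, Fin (a i).natAbs) :
    vertical a (fun _ => false) x = decide (a x.1 < 0) := by
  rw [vertical, Bool.false_xor]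

/-- Flipping before turning exchanges the two splicings, so the faces of the all-`A` dessin are the
circles of the all-`B` state. -/
theorem dessinA_rot_mul_flip :
    (pretzel a ha).dessinA.rot * (pretzel a ha).dessinA.flip =
      (pretzel a ha).edge * (pretzel a ha).turn fun _ => false :=
  (mul_assoc _ _ _).trans (congrArg _ (turn_mul_opp _ _))

theorem numSpanningTrees_dessinA (hpos : ∃ i, ¬ a i < 0) :
    (pretzel a ha).dessinA.numSpanningTrees =
      ∑ i with ¬ a i < 0, ∏ j ∈ Finset.univ.erase i, (a j).natAbs := by
  obtain ⟨L, hL⟩ := exists_isPrevVertical (c := fun i => !decide (a i < 0)) (by simpa using hpos)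
  rw [(pretzel a ha).dessinA.numSpanningTrees_eq (F := circleOf L) (e := Prod.fst)
    (dessin_sameCycle_iff ha vertical_true hL) (circleOf_surjective (natAbs_pos_of_ne ha))
    (fun x y => sameCycle_opp) Prod.fst_surjective]
  refine (card_isTree (natAbs_pos_of_ne ha) hL).trans ?_
  simp

theorem numSpanningTrees_dual_dessinA (hneg : ∃ i, a i < 0) :
    (pretzel a ha).dessinA.dual.numSpanningTrees =
      ∑ i with a i < 0, ∏ j ∈ Finset.univ.erase i, (a j).natAbs := by
  obtain ⟨L, hL⟩ := exists_isPrevVertical (c := fun i => decide (a i < 0)) (by simpa using hneg)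
  rw [(pretzel a ha).dessinA.dual.numSpanningTrees_eq (F := circleOf L) (e := Prod.fst)
    (fun x y => ?_) (circleOf_surjective (natAbs_pos_of_ne ha))
    (fun x y => sameCycle_opp) Prod.fst_surjective]
  · refine (card_isTree (natAbs_pos_of_ne ha) hL).trans ?_
    simp
  · change (((pretzel a ha).dessinA.rot * (pretzel a ha).dessinA.flip)⁻¹).SameCycle x y ↔ _
    -- The dual rotation is an inverse, which has the same cycles.
    refine Equiv.Perm.sameCycle_inv.trans ?_
    rw [dessinA_rot_mul_flip]
    exact dessin_sameCycle_iff ha vertical_false hL x y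

/-- Flips connect the two sides of a crossing, `down` connects the crossings of a column, and `top`
connects consecutive columns. -/
theorem card_component_dessinA (hN : 0 < N) : Nat.card (pretzel a ha).dessinA.Component = 1 := by
  have hb := natAbs_pos_of_ne ha
  refine Dessin.card_component_eq_one _ ⟨upperLeft hb ⟨0, hN⟩⟩ fun X F h1 h2 => ?_
  have hF := (invariant_iff_columnInvariant ha).1 h1
  have hflip : ∀ x e, F (x, e) = F (x, false) := by
    rintro x (_ | _)
    · rfl
    · exact h2 (x, false)
  have hcol : ∀ x e, F (x, e) = F (upperLeft hb x.1) := by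
    rintro ⟨i, k, hk⟩ e
    induction k generalizing e with
    | zero => exact hflip _ _
    | succ k ih => exact (hflip _ _).trans ((hF.down i k hk).trans (ih _ _))
  have hall : ∀ i, F (upperLeft hb i) = F (upperLeft hb ⟨0, hN⟩) := by
    refine finRotate_induction ⟨0, hN⟩ rfl fun j hj => ?_
    exact (hF.top j).trans ((hcol _ _).trans hj)
  rintro ⟨x, e⟩ ⟨y, e'⟩
  exact (hcol x e).trans ((hall _).trans ((hall _).symm.trans (hcol y e').symm))

/-- A column with `b` crossings contributes `1` to one of `v`, `f` and `b - 1` to the other. Hence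
`v + f = e`, and the genus equals the number of components, which is one. -/
theorem genus_dessinA (hpos : ∃ i, ¬ a i < 0) (hneg : ∃ i, a i < 0) :
    (pretzel a ha).dessinA.genus = 1 := by
  have hb := natAbs_pos_of_ne ha
  obtain ⟨L, hL⟩ := exists_isPrevVertical (c := fun i => !decide (a i < 0)) (by simpa using hpos)
  obtain ⟨L', hL'⟩ := exists_isPrevVertical (c := fun i => decide (a i < 0)) (by simpa using hneg)
  have hk := card_component_dessinA ha (Nat.pos_of_ne_zero fun h => by
    subst h; obtain ⟨i, -⟩ := hpos; exact i.elim0)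
  have hv : Nat.card (pretzel a ha).dessinA.Vertex = Nat.card (Circle _ _) :=
    Nat.card_congr (Equiv.Perm.cyclesEquiv (dessin_sameCycle_iff ha vertical_true hL)
      (circleOf_surjective hb))
  have hf : Nat.card (pretzel a ha).dessinA.Face = Nat.card (Circle _ _) :=
    Nat.card_congr (Equiv.Perm.cyclesEquiv (f := _ * _) (F := circleOf L') (fun x y => by
      rw [dessinA_rot_mul_flip]; exact dessin_sameCycle_iff ha vertical_false hL' x y)
      (circleOf_surjective hb))
  have he : Nat.card (pretzel a ha).dessinA.Edge = Nat.card (Σ i, Fin (a i).natAbs) :=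
    Nat.card_congr (Equiv.Perm.cyclesEquiv (F := Prod.fst) (fun x y => sameCycle_opp)
      Prod.fst_surjective)
  have hsum : (Nat.card (pretzel a ha).dessinA.Vertex : ℤ) +
      Nat.card (pretzel a ha).dessinA.Face = Nat.card (pretzel a ha).dessinA.Edge := by
    rw [hv, hf, he, card_circle hb, card_circle hb, ← Finset.sum_add_distrib, Nat.card_sigma]
    simp only [Nat.card_eq_fintype_card, Fintype.card_fin]
    rw [Nat.cast_sum]
    refine Finset.sum_congr rfl fun i _ => ?_
    by_cases h : a i < 0 <;> simp [h]
  have hsum' : (Nat.card (pretzel a ha).dessinA.Vertex : ℚ) +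
      Nat.card (pretzel a ha).dessinA.Face = Nat.card (pretzel a ha).dessinA.Edge := by
    exact_mod_cast hsum
  rw [Dessin.genus, hk, ← hsum']
  push_cast
  ring

end Pretzel

/-! ### The bracket at `A = exp (π i / 4)` -/

theorem rootA_pow_two : ((rootA ^ (2 : ℤ) : ℂˣ) : ℂ) = Complex.I := by
  rw [Units.val_zpow_eq_zpow_val, rootA, Units.val_mk0, ← Complex.exp_int_mul]
  refine (congrArg Complex.exp ?_).trans Complex.exp_pi_div_two_mul_I
  push_cast
  ring

theorem rootA_pow_neg_two : ((rootA ^ (-2 : ℤ) : ℂˣ) : ℂ) = -Complex.I := by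
  rw [zpow_neg, Units.val_inv_eq_inv_val, rootA_pow_two, Complex.inv_I]

theorem norm_rootA_zpow (k : ℤ) : ‖((rootA ^ k : ℂˣ) : ℂ)‖ = 1 := by
  have h : ‖(rootA : ℂ)‖ = 1 := by
    rw [rootA, Units.val_mk0, show (Real.pi * Complex.I / 4 : ℂ) = ((Real.pi / 4 : ℝ) : ℂ) *
      Complex.I by push_cast; ring, Complex.norm_exp_ofReal_mul_I]
  rw [Units.val_zpow_eq_zpow_val, norm_zpow, h, one_zpow]

/-- Since `A² + A⁻² = 0`, a power of the loop value survives only with exponent zero. Positivity of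
the number of circles excludes the truncated subtraction `0 - 1`. -/
theorem eval_bracket (D : LinkDiagram) (h : ∀ s, 0 < D.numCircles s) :
    LaurentPolynomial.eval₂ (Int.castRingHom ℂ) rootA D.bracket =
      ∑ s : D.State, if D.numCircles s = 1 then
        ((rootA ^ (∑ c, if s c then (1 : ℤ) else -1) : ℂˣ) : ℂ) else 0 := by
  rw [bracket, map_sum]
  refine Finset.sum_congr rfl fun s _ => ?_
  rw [map_mul, map_pow, map_sub, map_neg, LaurentPolynomial.eval₂_T, LaurentPolynomial.eval₂_T,
    LaurentPolynomial.eval₂_T, rootA_pow_two, rootA_pow_neg_two, sub_self]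
  have := h s
  split_ifs with h1
  · rw [h1, Nat.sub_self, pow_zero, mul_one]
  · rw [zero_pow (by omega), mul_zero]

/-- The writhe factor has modulus one, so the orientation does not matter. -/
theorem Orientation.det_eq {D : LinkDiagram} (o : D.Orientation) :
    o.det = ‖LaurentPolynomial.eval₂ (Int.castRingHom ℂ) rootA D.bracket‖ := by
  rw [Orientation.det, Orientation.jones, map_mul, map_mul, LaurentPolynomial.eval₂_T,
    LaurentPolynomial.eval₂_C, norm_mul, norm_mul, norm_rootA_zpow]
  simp

section Pretzel

variable {N : ℕ} {a : Fin N → ℤ} (ha : ∀ i, a i ≠ 0)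

theorem vertical_bijective (a : Fin N → ℤ) : Function.Bijective (vertical a) := by
  refine (Function.Involutive.bijective fun s => funext fun x => ?_)
  simp [vertical]

/-- The difference of the numbers of `A`- and `B`-splicings in a state with one circle. -/
theorem sum_splicings {s : (Σ i, Fin (a i).natAbs) → Bool} {i : Fin N}
    (h : IsUnicursal (vertical a s) i) :
    (∑ x, if s x then (1 : ℤ) else -1) =
      ∑ j, (if a j < 0 then -1 else 1) * ((a j).natAbs - 2 : ℤ) + (if a i < 0 then -2 else 2) := by
  -- If all columns had one cut, the sum would be the common term of the statement; the missing cut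
  -- in column `i` shifts it by `± 2`.
  have h1 : ∀ j, (∑ k, if s ⟨j, k⟩ then (1 : ℤ) else -1) = (if a j < 0 then -1 else 1) *
      ((a j).natAbs - 2 * cuts (vertical a s) j (a j).natAbs : ℤ) := by
    intro j
    have h2 : ((a j).natAbs : ℤ) = ∑ _k : Fin (a j).natAbs, (1 : ℤ) := by simp
    rw [cuts_all_eq_sum]
    conv_rhs => rw [h2]
    rw [Finset.mul_sum, ← Finset.sum_sub_distrib, Finset.mul_sum]
    refine Finset.sum_congr rfl fun k _ => ?_
    by_cases hj : a j < 0 <;> cases hs : s ⟨j, k⟩ <;> simp [vertical, hj, hs]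
  rw [Fintype.sum_sigma, Finset.sum_congr rfl fun j _ => h1 j,
    ← Finset.add_sum_erase _ _ (Finset.mem_univ i), ← Finset.add_sum_erase _
    (fun j => (if a j < 0 then -1 else 1) * ((a j).natAbs - 2 : ℤ)) (Finset.mem_univ i), h.1,
    Finset.sum_congr rfl fun j hj => by rw [h.2 j (Finset.ne_of_mem_erase hj)]]
  split_ifs <;> push_cast <;> ring

theorem eval_bracket_pretzel (hN : 0 < N) :
    LaurentPolynomial.eval₂ (Int.castRingHom ℂ) rootA (pretzel a ha).bracket =
      ((rootA ^ (∑ j, (if a j < 0 then -1 else 1) * ((a j).natAbs - 2 : ℤ)) : ℂˣ) : ℂ) * Complex.I *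
        ((∑ i, (if a i < 0 then -1 else 1) * ∏ j ∈ Finset.univ.erase i, (a j).natAbs : ℤ) : ℂ) := by
  classical
  rw [eval_bracket _ (numCircles_pos ha hN)]
  set K : ℤ := ∑ j, (if a j < 0 then -1 else 1) * ((a j).natAbs - 2 : ℤ)
  -- The column of a unicursal state is unique, so the sum over `i` has at most one nonzero term.
  -- That term uses `A ^ (± 2) = ± i`.
  trans ∑ s : (Σ i, Fin (a i).natAbs) → Bool, ∑ i, if IsUnicursal (vertical a s) i then
    ((rootA ^ K : ℂˣ) : ℂ) * Complex.I * ((if a i < 0 then -1 else 1 : ℤ) : ℂ) else 0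
  · refine Finset.sum_congr rfl fun s _ => ?_
    split_ifs with h1
    · obtain ⟨i, hi⟩ := (numCircles_eq_one_iff ha hN s).1 h1
      rw [Finset.sum_eq_single i (fun j _ hj => if_neg fun hj' => hj (hj'.unique hi))
        (fun h => (h (Finset.mem_univ i)).elim), if_pos hi]
      have h2 := sum_splicings hi
      refine (congrArg (fun k : ℤ => ((rootA ^ k : ℂˣ) : ℂ)) h2).trans ?_
      rw [zpow_add, Units.val_mul, mul_assoc]
      congr 1
      split_ifs
      · rw [rootA_pow_neg_two]; simp
      · rw [rootA_pow_two]; simp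
    · rw [numCircles_eq_one_iff ha hN] at h1
      push Not at h1
      exact (Finset.sum_eq_zero fun i _ => if_neg (h1 i)).symm
  · rw [Finset.sum_comm, Int.cast_sum, Finset.mul_sum]
    refine Finset.sum_congr rfl fun i _ => ?_
    have hcard : Nat.card {s // IsUnicursal (vertical a s) i} = _ :=
      (Nat.card_congr ((Equiv.ofBijective _ (vertical_bijective a)).subtypeEquiv
        fun s => Iff.rfl)).trans (card_isUnicursal i)
    rw [← Finset.sum_filter, Finset.sum_const, ← Fintype.card_subtype, ← Nat.card_eq_fintype_card,
      hcard, nsmul_eq_mul, Int.cast_mul, Int.cast_natCast]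
    ring

theorem Orientation.det_pretzel (hN : 0 < N) (o : (pretzel a ha).Orientation) :
    o.det = |((∑ i, (if a i < 0 then -1 else 1) *
      ∏ j ∈ Finset.univ.erase i, (a j).natAbs : ℤ) : ℝ)| := by
  rw [o.det_eq, eval_bracket_pretzel ha hN, norm_mul, norm_mul, norm_rootA_zpow, Complex.norm_I,
    one_mul, one_mul, Complex.norm_intCast]

end Pretzel

end LinkDiagram

/-! ### The pretzel link with positive and negative columns -/

theorem mainTheorem7 {n m : ℕ} (hn : 1 ≤ n) (hm : 1 ≤ m) (p : Fin n → ℕ) (q : Fin m → ℕ)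
    (hp : ∀ i, 0 < p i) (hq : ∀ j, 0 < q j) :
    (LinkDiagram.pretzelPQ p q hp hq).dessinA.genus = 1 ∧
    ∀ o : (LinkDiagram.pretzelPQ p q hp hq).Orientation,
      o.det = |(∏ i, (p i : ℝ)) * (∏ j, (q j : ℝ)) *
        (∑ i, 1 / (p i : ℝ) - ∑ j, 1 / (q j : ℝ))| ∧
      o.det = |((LinkDiagram.pretzelPQ p q hp hq).dessinA.numSpanningTrees : ℝ) -
        ((LinkDiagram.pretzelPQ p q hp hq).dessinA.dual.numSpanningTrees : ℝ)| := by
  rw [LinkDiagram.pretzelPQ]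
  generalize_proofs ha
  have hpos : ∃ i, ¬ Fin.append (fun i => (p i : ℤ)) (fun j => -(q j : ℤ)) i < 0 :=
    ⟨Fin.castAdd m ⟨0, hn⟩, by rw [Fin.append_left]; simp⟩
  have hneg : ∃ i, Fin.append (fun i => (p i : ℤ)) (fun j => -(q j : ℤ)) i < 0 :=
    ⟨Fin.natAdd n ⟨0, hm⟩, by rw [Fin.append_right]; simpa using hq ⟨0, hm⟩⟩
  refine ⟨LinkDiagram.genus_dessinA ha hpos hneg, fun o => ?_⟩
  rw [o.det_pretzel ha (by omega), LinkDiagram.numSpanningTrees_dessinA ha hpos,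
    LinkDiagram.numSpanningTrees_dual_dessinA ha hneg]
  constructor
  · congr 1
    -- The product over the other columns is the full product divided by the entry of column `i`.
    have h : ∀ i, ((∏ j ∈ Finset.univ.erase i,
        (Fin.append (fun i => (p i : ℤ)) (fun j => -(q j : ℤ)) j).natAbs : ℕ) : ℝ) =
        (∏ i, (p i : ℝ)) * (∏ j, (q j : ℝ)) *
          (1 / ((Fin.append (fun i => (p i : ℤ)) (fun j => -(q j : ℤ)) i).natAbs : ℝ)) := by
      intro i
      have h2 := Finset.mul_prod_erase Finset.univ (fun j =>
        ((Fin.append (fun i => (p i : ℤ)) (fun j => -(q j : ℤ)) j).natAbs : ℝ)) (Finset.mem_univ i)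
      rw [Fin.prod_univ_add] at h2
      simp only [Fin.append_left, Fin.append_right, Int.natAbs_neg, Int.natAbs_natCast] at h2
      have h3 : ((Fin.append (fun i => (p i : ℤ)) (fun j => -(q j : ℤ)) i).natAbs : ℝ) ≠ 0 := by
        rw [Nat.cast_ne_zero, Int.natAbs_ne_zero]
        exact ha i
      rw [← h2, Nat.cast_prod]
      field_simp
    rw [Int.cast_sum, mul_sub, Finset.mul_sum, Finset.mul_sum, Fin.sum_univ_add,
      sub_eq_add_neg, ← Finset.sum_neg_distrib]
    congr 1
    · refine Finset.sum_congr rfl fun i _ => ?_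
      rw [Int.cast_mul, Int.cast_natCast, h]
      simp
    · refine Finset.sum_congr rfl fun i _ => ?_
      rw [Int.cast_mul, Int.cast_natCast, h]
      simp [hq i]
  · congr 1
    rw [Finset.sum_filter, Finset.sum_filter, Nat.cast_sum, Nat.cast_sum, Int.cast_sum,
      ← Finset.sum_sub_distrib]
    refine Finset.sum_congr rfl fun i _ => ?_
    split_ifs <;> simp
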